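/- Let $p\in[1,9/4)$. Let $u,b,w:\mathbb{R}^3\to\mathbb{R}^3$ and $\Pi:\mathbb{R}^3\to\mathbb{R}$ be $C^\infty$ functions satisfying, everywhere on $\mathbb{R}^3$, the stationary magneto-micropolar system (with angular viscosity, magnetic diffusivity and micro-rotational viscosity all equal to $1$) $$ \begin{aligned} -\Delta u+(u\cdot\nabla)u+\nabla\Pi&=\nabla\times w+(b\cdot\nabla)b,\\ -\Delta w+(u\cdot\nabla)w&=\nabla(\nabla\cdot w)+\nabla\times u-2w,\\ -\Delta b+(u\cdot\nabla)b&=(b\cdot\nabla)u,\\ \nabla\cdot u=\nabla\cdot b&=0 . \end{aligned} $$ Assume that $u,b,w\in L^p(\mathbb{R}^3)$ and that $u(x)\to 0$, $b(x)\to 0$ and $w(x)\to 0$ as $|x|\to\infty$. Then $u\equiv b\equiv w\equiv 0$ on $\mathbb{R}^3$. -/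

import Mathlib

open MeasureTheory Filter
open scoped Topology ContDiff Laplacian Gradient

/-- The Euclidean space `ℝ³`. -/
abbrev E3 : Type := EuclideanSpace ℝ (Fin 3)

/-- The `j`-th standard basis vector of `ℝ³`. -/
noncomputable def stdVec (j : Fin 3) : E3 := EuclideanSpace.single j (1 : ℝ)

/-- The partial derivative `∂ⱼ vᵢ` of a vector field at the point `x`. -/
noncomputable def pd (v : E3 → E3) (j i : Fin 3) (x : E3) : ℝ :=
  fderiv ℝ v x (stdVec j) i

/-- The divergence `∇ · v = ∑ⱼ ∂ⱼ vⱼ`. -/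
noncomputable def dvg (v : E3 → E3) (x : E3) : ℝ := ∑ j, pd v j j x

/-- The rotation `∇ × v = (∂₁v₂ - ∂₂v₁, …)` (coordinates indexed by `0, 1, 2`). -/
noncomputable def rot (v : E3 → E3) (x : E3) : E3 :=
  !₂[pd v 1 2 x - pd v 2 1 x, pd v 2 0 x - pd v 0 2 x, pd v 0 1 x - pd v 1 0 x]

/-- The advection term `(u · ∇) v = ∑ⱼ uⱼ ∂ⱼ v`, the derivative of `v` in direction `u`. -/
noncomputable def adv (u v : E3 → E3) (x : E3) : E3 := fderiv ℝ v x (u x)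

/-- `(u, b, w, P)` is a smooth classical solution on `ℝ³` of the stationary magneto-micropolar
equations, with all the viscosity constants equal to `1`: velocity `u`, magnetic field `b`,
micro-rotational velocity `w`, pressure `P`. -/
structure IsSmoothSolution (u b w : E3 → E3) (P : E3 → ℝ) : Prop where
  smooth_u : ContDiff ℝ ∞ u
  smooth_b : ContDiff ℝ ∞ b
  smooth_w : ContDiff ℝ ∞ w
  smooth_P : ContDiff ℝ ∞ P
  momentum : ∀ x, -(Δ u) x + adv u u x + ∇ P x = rot w x + adv b b x
  angular : ∀ x, -(Δ w) x + adv u w x = ∇ (dvg w) x + rot u x - (2 : ℝ) • w x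
  magnetic : ∀ x, -(Δ b) x + adv u b x = adv b u x
  div_u : ∀ x, dvg u x = 0
  div_b : ∀ x, dvg b x = 0

/-! The proof is an energy estimate on growing balls. Test the three equations with `φ u`, `φ w` and
`φ b`, where `φ` is a cutoff at scale `R`, and add them. Incompressibility turns the transport and
magnetic terms into divergences. The coupling between `u` and `w` is, up to a divergence, `2 w ·
curl u`. Young's inequality bounds this by the damping `2 |w|²` plus `|curl u|² / 2`, and `|curl
u|²` equals `|∇u|²` up to a second-order divergence. At least half of the Dirichlet energy density
therefore survives pointwise, bounded by a sum of divergences minus `u · ∇P` (`energy_inequality`).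

The fields are continuous and vanish at infinity, so they are bounded. Together with the `Lᵖ`
hypothesis this puts them in `L^(9/4)` and `L⁴`. The former gives `∫_{B_{2R}} |v|² = o(R)` for each
field (`sublinearGrowth_sq`). Each flux is a first or second derivative of a quantity bounded by a
constant times `ρ = |u|² + |b|² + |w|²`. Moving the derivatives onto `φ` costs `O(1/R)`, so the
fluxes vanish in the limit (`negligible_energyFlux`).

The pressure has no assumed decay and is never estimated itself: the term `∫ φ u · ∇P` is the weak
momentum form evaluated at `F = φ u`. Let `G` solve `η⁴ G - Δ G = F` and put `g = div G`. Then `F =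
curl curl G + η⁴ G - ∇g`. The weak form vanishes on the solenoidal part `curl curl G`, and its value
at `η⁴ G` is `O(η)`. At `∇g` it is the pairing of `u ⊗ u - b ⊗ b`, which lies in `L²`, with the
Hessian of `g`, whose `L²` norm is controlled by that of `div F`. Letting `η → 0` gives
`abs_weakForm_le`. Since `div F = u · ∇φ` tends to zero in `L²`, the pressure drops out
(`negligible_pressure`).

All gradients then vanish, so the fields are constant, and the limit at infinity makes them zero. -/

/-- The partial derivative `∂ⱼ f` of a scalar function on `ℝ³`. -/
noncomputable def partialD (j : Fin 3) (f : E3 → ℝ) (x : E3) : ℝ := fderiv ℝ f x (stdVec j)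

theorem two_le_infty : (2 : WithTop ℕ∞) ≤ ∞ := WithTop.coe_le_coe.2 (le_top (a := (2 : ℕ∞)))

/-! ### Partial derivatives and integration by parts -/

section partialD

variable {f g : E3 → ℝ} {j : Fin 3} {x : E3}

theorem ContDiff.partialD (hf : ContDiff ℝ ∞ f) (j : Fin 3) : ContDiff ℝ ∞ (partialD j f) :=
  (hf.fderiv_right (m := ∞) (by simp)).clm_apply contDiff_const

theorem ContDiff.differentiableAt_top (hf : ContDiff ℝ ∞ f) : DifferentiableAt ℝ f x :=
  hf.differentiable (by simp) x

theorem partialD_add (hf : ContDiff ℝ ∞ f) (hg : ContDiff ℝ ∞ g) :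
    partialD j (fun y => f y + g y) x = partialD j f x + partialD j g x := by
  simp [partialD, fderiv_fun_add hf.differentiableAt_top hg.differentiableAt_top]

theorem partialD_sub (hf : ContDiff ℝ ∞ f) (hg : ContDiff ℝ ∞ g) :
    partialD j (fun y => f y - g y) x = partialD j f x - partialD j g x := by
  simp [partialD, fderiv_fun_sub hf.differentiableAt_top hg.differentiableAt_top]

theorem partialD_mul (hf : ContDiff ℝ ∞ f) (hg : ContDiff ℝ ∞ g) :
    partialD j (fun y => f y * g y) x = f x * partialD j g x + g x * partialD j f x := by
  simp [partialD, fderiv_fun_mul hf.differentiableAt_top hg.differentiableAt_top]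

theorem partialD_sum {ι : Type*} (s : Finset ι) {F : ι → E3 → ℝ}
    (hF : ∀ k, ContDiff ℝ ∞ (F k)) :
    partialD j (fun y => ∑ k ∈ s, F k y) x = ∑ k ∈ s, partialD j (F k) x := by
  simp [partialD, fderiv_fun_sum fun k _ => (hF k).differentiableAt_top]

theorem partialD_comm (hf : ContDiff ℝ ∞ f) (i j : Fin 3) (x : E3) :
    partialD i (partialD j f) x = partialD j (partialD i f) x := by
  have key : ∀ k l : Fin 3, partialD k (partialD l f) x
      = fderiv ℝ (fderiv ℝ f) x (stdVec k) (stdVec l) := by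
    intro k l
    have h1 : DifferentiableAt ℝ (fderiv ℝ f) x :=
      (hf.fderiv_right (m := ∞) (by simp)).differentiable (by simp) x
    unfold partialD
    rw [fderiv_clm_apply h1 (differentiableAt_const _)]
    simp
  rw [key, key]
  exact (hf.contDiffAt.isSymmSndFDerivAt (n := ∞) (by simpa using two_le_infty)) _ _

theorem HasCompactSupport.partialD (hf : HasCompactSupport f) (j : Fin 3) :
    HasCompactSupport (partialD j f) :=
  hf.fderiv_apply ℝ (stdVec j)

/-- Integration by parts against a compactly supported function. -/
theorem integral_mul_partialD (hf : ContDiff ℝ ∞ f) (hg : ContDiff ℝ ∞ g)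
    (hc : HasCompactSupport g) (j : Fin 3) :
    ∫ y, f y * partialD j g y = -∫ y, partialD j f y * g y := by
  unfold partialD
  refine integral_mul_fderiv_eq_neg_fderiv_mul_of_integrable ?_ ?_ ?_
    (fun _ _ => hf.differentiableAt_top) (fun _ _ => hg.differentiableAt_top)
  · exact ((hf.partialD j).continuous.mul hg.continuous).integrable_of_hasCompactSupport
      hc.mul_left
  · exact (hf.continuous.mul (hg.partialD j).continuous).integrable_of_hasCompactSupport
      (hc.partialD j).mul_left
  · exact (hf.continuous.mul hg.continuous).integrable_of_hasCompactSupport hc.mul_left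

/-- Two integrations by parts against a compactly supported function. -/
theorem integral_mul_partialD_partialD (hf : ContDiff ℝ ∞ f) (hg : ContDiff ℝ ∞ g)
    (hc : HasCompactSupport g) (i j : Fin 3) :
    ∫ y, f y * partialD i (partialD j g) y = ∫ y, partialD j (partialD i f) y * g y := by
  rw [integral_mul_partialD hf (hg.partialD j) (hc.partialD j),
    integral_mul_partialD (hf.partialD i) hg hc, neg_neg]

end partialD

/-! ### The differential operators in components -/

/-- The rotation of a vector field given by its components. -/
noncomputable def curl (v : Fin 3 → E3 → ℝ) (i : Fin 3) (x : E3) : ℝ :=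
  ![partialD 1 (v 2) x - partialD 2 (v 1) x, partialD 2 (v 0) x - partialD 0 (v 2) x,
    partialD 0 (v 1) x - partialD 1 (v 0) x] i

/-- The components of a vector field. -/
def comps (v : E3 → E3) (i : Fin 3) (x : E3) : ℝ := v x i

section comps

variable {v : E3 → E3} {x : E3}

theorem ContDiff.comps (hv : ContDiff ℝ ∞ v) (i : Fin 3) : ContDiff ℝ ∞ (comps v i) :=
  (EuclideanSpace.proj (𝕜 := ℝ) i).contDiff.comp hv

theorem fderiv_apply_eq_fderiv_comps (hv : ContDiff ℝ ∞ v) (i : Fin 3) (y : E3) :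
    fderiv ℝ v x y i = fderiv ℝ (comps v i) x y := by
  have h : comps v i = (EuclideanSpace.proj (𝕜 := ℝ) i) ∘ v := rfl
  rw [h, fderiv_comp x (EuclideanSpace.proj (𝕜 := ℝ) i).differentiableAt
    (hv.differentiable (by simp) x), ContinuousLinearMap.fderiv]
  rfl

theorem pd_eq_partialD (hv : ContDiff ℝ ∞ v) (j i : Fin 3) :
    pd v j i x = partialD j (comps v i) x :=
  fderiv_apply_eq_fderiv_comps hv i _

theorem dvg_eq_sum (hv : ContDiff ℝ ∞ v) :
    dvg v x = ∑ j, partialD j (comps v j) x := by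
  simp [dvg, pd_eq_partialD hv]

theorem rot_apply (hv : ContDiff ℝ ∞ v) (i : Fin 3) : rot v x i = curl (comps v) i x := by
  fin_cases i <;> simp [rot, curl, pd_eq_partialD hv]

theorem sum_smul_stdVec (y : E3) : ∑ j, y j • stdVec j = y := by
  ext i
  fin_cases i <;> simp [stdVec, Fin.sum_univ_three]

theorem fderiv_eq_sum_partialD (f : E3 → ℝ) (y : E3) :
    fderiv ℝ f x y = ∑ j, y j * partialD j f x := by
  conv_lhs => rw [← sum_smul_stdVec y]
  simp [partialD]

theorem adv_apply {v' : E3 → E3} (hv : ContDiff ℝ ∞ v) (i : Fin 3) :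
    adv v' v x i = ∑ j, comps v' j x * partialD j (comps v i) x := by
  rw [adv, fderiv_apply_eq_fderiv_comps hv, fderiv_eq_sum_partialD]
  rfl

theorem gradient_apply (f : E3 → ℝ) (i : Fin 3) : ∇ f x i = partialD i f x := by
  have h := InnerProductSpace.toDual_symm_apply (𝕜 := ℝ) (x := stdVec i) (y := fderiv ℝ f x)
  rw [partialD, ← h, gradient]
  rw [stdVec, EuclideanSpace.inner_single_right]
  simp

theorem laplacian_apply_eq_sum (hv : ContDiff ℝ ∞ v) (i : Fin 3) :
    (Δ v) x i = ∑ j, partialD j (partialD j (comps v i)) x := by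
  have h1 : (Δ v) x i = (Δ (comps v i)) x := by
    have := (hv.contDiffAt (x := x) |>.of_le (m := 2) two_le_infty).laplacian_CLM_comp_left
      (l := EuclideanSpace.proj (𝕜 := ℝ) i)
    exact this.symm
  rw [h1, InnerProductSpace.laplacian_eq_iteratedFDeriv_orthonormalBasis _
    (EuclideanSpace.basisFun (Fin 3) ℝ)]
  refine Finset.sum_congr rfl fun j _ => ?_
  have h2 : DifferentiableAt ℝ (fderiv ℝ (comps v i)) x :=
    ((hv.comps i).fderiv_right (m := ∞) (by simp)).differentiable (by simp) x
  unfold partialD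
  rw [fderiv_clm_apply h2 (differentiableAt_const _), iteratedFDeriv_two_apply]
  simp [stdVec]

end comps

/-! ### Cutoffs, and truncation of Schwartz functions -/

open scoped SchwartzMap BoundedContinuousFunction ZeroAtInfty LineDeriv

/-- A smooth function equal to `1` on the ball of radius `n + 1` and vanishing outside the ball of
radius `2 (n + 1)`, obtained by rescaling a fixed bump function. -/
noncomputable def cutoff (n : ℕ) (x : E3) : ℝ :=
  (⟨1, 2, one_pos, one_lt_two⟩ : ContDiffBump (0 : E3)) (((n : ℝ) + 1)⁻¹ • x)

section cutoff

variable (n : ℕ) {x : E3}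

theorem cutoff_eq (n : ℕ) : cutoff n = fun x => cutoff 0 (((n : ℝ) + 1)⁻¹ • x) := by
  funext x
  simp [cutoff]

theorem contDiff_cutoff : ContDiff ℝ ∞ (cutoff n) :=
  (ContDiffBump.contDiff _).comp (contDiff_const_smul _)

theorem cutoff_nonneg : 0 ≤ cutoff n x := ContDiffBump.nonneg _

theorem cutoff_le_one : cutoff n x ≤ 1 := ContDiffBump.le_one _

theorem norm_inv_smul_add_one : ‖((n : ℝ) + 1)⁻¹ • x‖ = ‖x‖ / (n + 1) := by
  rw [norm_smul, norm_inv, Real.norm_of_nonneg (by positivity)]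
  ring

theorem cutoff_eq_one (hx : ‖x‖ ≤ n + 1) : cutoff n x = 1 := by
  apply ContDiffBump.one_of_mem_closedBall
  rw [mem_closedBall_zero_iff, norm_inv_smul_add_one]
  exact (div_le_one (by positivity)).2 hx

theorem support_cutoff_subset :
    Function.support (cutoff n) ⊆ Metric.closedBall 0 (2 * ((n : ℝ) + 1)) := by
  intro x hx
  rw [Function.mem_support] at hx
  contrapose! hx
  apply ContDiffBump.zero_of_le_dist
  rw [mem_closedBall_zero_iff, not_le] at hx
  rw [dist_zero_right, norm_inv_smul_add_one]
  exact (le_div_iff₀ (by positivity)).2 hx.le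

theorem tsupport_cutoff_subset :
    tsupport (cutoff n) ⊆ Metric.closedBall 0 (2 * ((n : ℝ) + 1)) :=
  closure_minimal (support_cutoff_subset n) Metric.isClosed_closedBall

theorem hasCompactSupport_cutoff : HasCompactSupport (cutoff n) :=
  HasCompactSupport.of_support_subset_isCompact (isCompact_closedBall _ _)
    (support_cutoff_subset n)

theorem exists_norm_iteratedFDeriv_cutoff_le (m : ℕ) :
    ∃ C, 0 ≤ C ∧ ∀ (n : ℕ) (x : E3),
      ‖iteratedFDeriv ℝ m (cutoff n) x‖ ≤ C * (((n : ℝ) + 1)⁻¹) ^ m := by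
  have hc : HasCompactSupport (iteratedFDeriv ℝ m (cutoff 0)) :=
    (hasCompactSupport_cutoff 0).iteratedFDeriv m
  obtain ⟨C, hC⟩ := hc.exists_bound_of_continuous
    ((contDiff_cutoff 0).continuous_iteratedFDeriv (mod_cast le_top))
  refine ⟨C, (norm_nonneg _).trans (hC 0), fun n x => ?_⟩
  rw [cutoff_eq n, iteratedFDeriv_comp_const_smul _
    ((contDiff_cutoff 0).of_le (mod_cast le_top)), norm_smul, norm_pow, norm_inv,
    Real.norm_of_nonneg (by positivity : (0 : ℝ) ≤ (n : ℝ) + 1), mul_comm]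
  gcongr
  exact hC _

end cutoff

/-- The truncation of a Schwartz function by a cutoff. -/
noncomputable def truncate (S : 𝓢(E3, ℝ)) (n : ℕ) : 𝓢(E3, ℝ) :=
  ((hasCompactSupport_cutoff n).mul_right (f' := S)).toSchwartzMap
    ((contDiff_cutoff n).mul (S.smooth ⊤))

theorem truncate_apply (S : 𝓢(E3, ℝ)) (n : ℕ) (x : E3) :
    truncate S n x = cutoff n x * S x := rfl

theorem hasCompactSupport_truncate (S : 𝓢(E3, ℝ)) (n : ℕ) : HasCompactSupport (truncate S n) :=
  (hasCompactSupport_cutoff n).mul_right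

theorem exists_norm_iteratedFDeriv_cutoff_sub_one_le (m : ℕ) :
    ∃ C, 0 ≤ C ∧ ∀ (n : ℕ) (x : E3),
      ‖iteratedFDeriv ℝ m (fun y => cutoff n y - 1) x‖ ≤ C := by
  rcases m with _ | m
  · refine ⟨1, zero_le_one, fun n x => ?_⟩
    rw [norm_iteratedFDeriv_zero, Real.norm_eq_abs, abs_le]
    constructor <;> linarith [cutoff_nonneg n (x := x), cutoff_le_one n (x := x)]
  · obtain ⟨C, hC0, hC⟩ := exists_norm_iteratedFDeriv_cutoff_le (m + 1)
    refine ⟨C, hC0, fun n x => ?_⟩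
    have h : iteratedFDeriv ℝ (m + 1) (fun y => cutoff n y - 1) x
        = iteratedFDeriv ℝ (m + 1) (cutoff n) x := by
      have := iteratedFDeriv_sub_apply (𝕜 := ℝ) (i := m + 1) (x := x) (f := cutoff n)
        (g := fun _ => (1 : ℝ)) ((contDiff_cutoff n).contDiffAt.of_le (mod_cast le_top))
        contDiffAt_const
      rw [iteratedFDeriv_const_of_ne (by simp), Pi.zero_apply, sub_zero] at this
      exact this
    rw [h]
    refine (hC n x).trans (mul_le_of_le_one_right hC0 (pow_le_one₀ (by positivity) ?_))
    exact inv_le_one_of_one_le₀ (by linarith [n.cast_nonneg (α := ℝ)])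

/-- The error `(cutoff n - 1) S` lives where `‖x‖ ≥ n + 1`. There one extra power of `‖x‖` taken
from the decay of `S` pays for a factor `1 / (n + 1)`, while the derivatives of the cutoffs are
bounded uniformly in `n`. -/
theorem tendsto_truncate (S : 𝓢(E3, ℝ)) : Tendsto (truncate S) atTop (𝓝 S) := by
  rw [(schwartz_withSeminorms ℝ E3 ℝ).tendsto_nhds]
  rintro ⟨k, m⟩ ε hε
  choose C hC0 hC using exists_norm_iteratedFDeriv_cutoff_sub_one_le
  set K : ℝ := ∑ i ∈ Finset.range (m + 1),
    (m.choose i : ℝ) * C i * SchwartzMap.seminorm ℝ (k + 1) (m - i) S with hK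
  have hKnn : 0 ≤ K := Finset.sum_nonneg fun i _ =>
    mul_nonneg (mul_nonneg (by positivity) (hC0 i)) (apply_nonneg _ _)
  have hbound : ∀ n : ℕ, SchwartzMap.seminorm ℝ k m (truncate S n - S) ≤ K * ((n : ℝ) + 1)⁻¹ := by
    intro n
    refine SchwartzMap.seminorm_le_bound ℝ k m _ (by positivity) fun x => ?_
    have hcoe : ⇑(truncate S n - S) = fun y => (cutoff n y - 1) * S y := by
      funext y
      rw [sub_apply, truncate_apply]
      ring
    rw [hcoe]
    rcases lt_or_ge ‖x‖ (n + 1) with hx | hx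
    · have h0 : (fun y => (cutoff n y - 1) * S y) =ᶠ[𝓝 x] fun _ => 0 := by
        filter_upwards [(continuous_norm.continuousAt (x := x)).eventually_lt_const hx] with y hy
        rw [cutoff_eq_one n hy.le, sub_self, zero_mul]
      rw [h0.iteratedFDeriv ℝ m |>.self_of_nhds]
      simp only [iteratedFDeriv_fun_zero, Pi.zero_apply, norm_zero, mul_zero]
      positivity
    · have h1 := norm_iteratedFDeriv_mul_le (𝕜 := ℝ) (N := ∞)
        ((contDiff_cutoff n).sub contDiff_const (g := fun _ => (1 : ℝ))) (S.smooth ⊤) x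
        (n := m) (mod_cast le_top)
      -- This factor is inserted below to trade the weight `‖x‖ ^ k` for `‖x‖ ^ (k + 1)` and a
      -- decaying constant.
      have hx0 : (1 : ℝ) ≤ ‖x‖ * ((n : ℝ) + 1)⁻¹ := by
        rw [← div_eq_mul_inv]
        exact (one_le_div (by positivity)).2 hx
      refine (mul_le_mul_of_nonneg_left h1 (by positivity)).trans ?_
      rw [hK, Finset.mul_sum, Finset.sum_mul]
      refine Finset.sum_le_sum fun i _ => ?_
      calc ‖x‖ ^ k * ((m.choose i : ℝ) * ‖iteratedFDeriv ℝ i (fun y => cutoff n y - 1) x‖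
            * ‖iteratedFDeriv ℝ (m - i) S x‖)
          ≤ ‖x‖ ^ k * ((m.choose i : ℝ) * C i * ‖iteratedFDeriv ℝ (m - i) S x‖) := by
            gcongr
            exact hC i n x
        _ = (m.choose i : ℝ) * C i * (‖x‖ ^ k * ‖iteratedFDeriv ℝ (m - i) S x‖) * 1 := by ring
        _ ≤ (m.choose i : ℝ) * C i * (‖x‖ ^ k * ‖iteratedFDeriv ℝ (m - i) S x‖)
              * (‖x‖ * ((n : ℝ) + 1)⁻¹) := by
            have := hC0 i
            gcongr
        _ = (m.choose i : ℝ) * C i * (‖x‖ ^ (k + 1) * ‖iteratedFDeriv ℝ (m - i) S x‖)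
              * ((n : ℝ) + 1)⁻¹ := by ring
        _ ≤ _ := by
            have := hC0 i
            gcongr
            exact SchwartzMap.le_seminorm ℝ (k + 1) (m - i) S x
  have hlim : Tendsto (fun n : ℕ => K * ((n : ℝ) + 1)⁻¹) atTop (𝓝 0) := by
    simpa [one_div] using tendsto_one_div_add_atTop_nhds_zero_nat.const_mul K
  filter_upwards [hlim.eventually_lt_const hε] with n hn
  exact (hbound n).trans_lt hn

/-- Compactly supported functions are dense among the Schwartz functions. -/
theorem dense_hasCompactSupport : Dense {S : 𝓢(E3, ℝ) | HasCompactSupport S} := fun S =>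
  mem_closure_of_tendsto (tendsto_truncate S)
    (Eventually.of_forall (hasCompactSupport_truncate S))

/-! ### Pairings of Schwartz functions with bounded functions -/

/-- Integration of Schwartz functions against a bounded continuous function. -/
noncomputable def integralAgainst (c : E3 →ᵇ ℝ) : 𝓢(E3, ℝ) →L[ℝ] ℝ :=
  have hint (S : 𝓢(E3, ℝ)) : Integrable fun x => c x * S x :=
    S.integrable.bdd_mul c.continuous.aestronglyMeasurable (.of_forall c.norm_coe_le_norm)
  SchwartzMap.mkCLMtoNormedSpace (fun S => ∫ x, c x * S x)
    (fun S T => by simp only [add_apply, mul_add]; exact integral_add (hint S) (hint T))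
    (fun a S => by
      simp only [smul_apply, smul_eq_mul, RingHom.id_apply, ← integral_const_mul]
      congr 1 with x
      ring)
    (by
      obtain ⟨k, C, hC0, hC⟩ := SchwartzMap.norm_toLp_le_seminorm ℝ (E := E3) ℝ 1 volume
      refine ⟨Finset.Iic (k, 0), ‖c‖ * C, by positivity, fun S => ?_⟩
      calc ‖∫ x, c x * S x‖ ≤ ∫ x, ‖c x * S x‖ := norm_integral_le_integral_norm _
        _ ≤ ∫ x, ‖c‖ * ‖S x‖ := by
          refine integral_mono (hint S).norm (S.integrable.norm.const_mul _) fun x => ?_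
          rw [norm_mul]
          exact mul_le_mul_of_nonneg_right (c.norm_coe_le_norm x) (norm_nonneg _)
        _ = ‖c‖ * ‖S.toLp 1 volume‖ := by
          rw [integral_const_mul, SchwartzMap.norm_toLp_one]
        _ ≤ _ := by
          rw [mul_assoc]
          gcongr
          exact hC S)

theorem integralAgainst_apply (c : E3 →ᵇ ℝ) (S : 𝓢(E3, ℝ)) :
    integralAgainst c S = ∫ x, c x * S x := rfl

/-! ### Solvability of the resolvent equation -/

theorem laplacian_eq_sum_stdVec {F : Type*} [NormedAddCommGroup F] [NormedSpace ℝ F]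
    (S : 𝓢(E3, F)) : Δ S = ∑ j, ∂_{stdVec j} (∂_{stdVec j} S) := by
  rw [SchwartzMap.laplacian_eq_sum (EuclideanSpace.basisFun (Fin 3) ℝ)]
  simp [stdVec]

theorem postcompCLM_lineDerivOp {F G : Type*} [NormedAddCommGroup F] [NormedSpace ℝ F]
    [NormedAddCommGroup G] [NormedSpace ℝ G] (L : F →L[ℝ] G) (S : 𝓢(E3, F)) (v : E3) :
    ∂_{v} (S.postcompCLM L) = (∂_{v} S).postcompCLM L := by
  ext x
  rw [SchwartzMap.lineDerivOp_apply_eq_fderiv, SchwartzMap.postcompCLM_apply,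
    SchwartzMap.lineDerivOp_apply_eq_fderiv]
  have h : ⇑(S.postcompCLM L) = L ∘ S := rfl
  rw [h, fderiv_comp x L.differentiableAt S.differentiableAt, ContinuousLinearMap.fderiv]
  rfl

theorem postcompCLM_laplacian {F G : Type*} [NormedAddCommGroup F] [NormedSpace ℝ F]
    [NormedAddCommGroup G] [NormedSpace ℝ G] (L : F →L[ℝ] G) (S : 𝓢(E3, F)) :
    Δ (S.postcompCLM L) = (Δ S).postcompCLM L := by
  simp_rw [laplacian_eq_sum_stdVec, map_sum, postcompCLM_lineDerivOp]

/-- The resolvent equation `ε G - Δ G = F` is solvable for complex-valued Schwartz functions. -/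
theorem exists_resolvent_complex {ε : ℝ} (hε : 0 < ε) (F : 𝓢(E3, ℂ)) :
    ∃ G : 𝓢(E3, ℂ), ε • G - Δ G = F := by
  -- With this `a`, the symbol `ε + (2π)² ‖ξ‖²` of `ε - Δ` is `ε (1 + ‖a ξ‖²)`, so `ε⁻¹ g` is its
  -- inverse.
  set a : ℝ := 2 * Real.pi / √ε with ha
  have hg : (fun x : E3 => (1 + ‖a • x‖ ^ 2) ^ (-1 : ℝ)).HasTemperateGrowth :=
    (Function.hasTemperateGrowth_one_add_norm_sq_rpow E3 (-1)).comp
      (ContinuousLinearMap.hasTemperateGrowth (a • ContinuousLinearMap.id ℝ E3))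
  set g : E3 → ℝ := fun x => (1 + ‖a • x‖ ^ 2) ^ (-1 : ℝ) with hgdef
  have hsq : (fun x : E3 => ‖x‖ ^ 2).HasTemperateGrowth := by fun_prop
  refine ⟨ε⁻¹ • SchwartzMap.fourierMultiplierCLM ℂ g F, ?_⟩
  have hlap : Δ (ε⁻¹ • SchwartzMap.fourierMultiplierCLM ℂ g F)
      = ε⁻¹ • Δ (SchwartzMap.fourierMultiplierCLM ℂ g F) := by
    simp_rw [← SchwartzMap.laplacianCLM_eq', map_smul]
  rw [hlap, SchwartzMap.laplacian_eq_fourierMultiplierCLM]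
  have h2 := SchwartzMap.fourierMultiplierCLM_fourierMultiplierCLM_apply hsq hg F
  change SchwartzMap.fourierMultiplierCLM ℂ (‖·‖ ^ 2) (SchwartzMap.fourierMultiplierCLM ℂ g F) = _
    at h2
  rw [h2]
  -- The resolvent equation on the Fourier side is the identity `g + a² ‖ξ‖² g = 1`.
  have hsum := SchwartzMap.fourierMultiplierCLM_sum ℂ (s := Finset.univ)
    (g := ![g, fun x => a ^ 2 * (‖x‖ ^ 2 * g x)])
    (by
      intro i _
      fin_cases i
      · exact hg
      · exact (Function.HasTemperateGrowth.const (a ^ 2)).mul (hsq.mul hg))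
  have h1 : (fun x : E3 => ∑ i : Fin 2, ![g, fun x => a ^ 2 * (‖x‖ ^ 2 * g x)] i x)
      = fun _ => (1 : ℝ) := by
    funext x
    have hpos : 0 < 1 + ‖a • x‖ ^ 2 := by positivity
    simp only [Fin.sum_univ_two, Matrix.cons_val_zero, Matrix.cons_val_one, hgdef,
      Real.rpow_neg_one]
    rw [← mul_assoc, show a ^ 2 * ‖x‖ ^ 2 = ‖a • x‖ ^ 2 by
      rw [norm_smul, mul_pow, Real.norm_eq_abs, sq_abs]]
    field_simp
  rw [h1, SchwartzMap.fourierMultiplierCLM_const, Fin.sum_univ_two] at hsum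
  simp only [Matrix.cons_val_zero, Matrix.cons_val_one] at hsum
  have h3 : SchwartzMap.fourierMultiplierCLM ℂ (fun x => a ^ 2 * (‖x‖ ^ 2 * g x))
      = a ^ 2 • SchwartzMap.fourierMultiplierCLM ℂ (fun x : E3 => ‖x‖ ^ 2 * g x) :=
    SchwartzMap.fourierMultiplierCLM_smul (hsq.mul hg) (a ^ 2)
  have h4 := congrArg (fun T : 𝓢(E3, ℂ) →L[ℝ] 𝓢(E3, ℂ) => T F) hsum
  rw [h3] at h4
  simp only [one_smul, ContinuousLinearMap.id_apply, add_apply, smul_apply] at h4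
  conv_rhs => rw [h4]
  have ha2 : a ^ 2 = (2 * Real.pi) ^ 2 * ε⁻¹ := by
    rw [ha, div_pow, Real.sq_sqrt hε.le]
    ring
  rw [smul_smul, mul_inv_cancel₀ hε.ne', one_smul, smul_smul, mul_neg, neg_smul, sub_neg_eq_add,
    ha2, mul_comm ε⁻¹]
  rfl

/-- The resolvent equation `ε G - Δ G = F` is solvable for real-valued Schwartz functions. -/
theorem exists_resolvent {ε : ℝ} (hε : 0 < ε) (F : 𝓢(E3, ℝ)) :
    ∃ G : 𝓢(E3, ℝ), ε • G - ∑ j, ∂_{stdVec j} (∂_{stdVec j} G) = F := by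
  obtain ⟨G, hG⟩ := exists_resolvent_complex hε (F.postcompCLM Complex.ofRealCLM)
  refine ⟨G.postcompCLM Complex.reCLM, ?_⟩
  rw [← laplacian_eq_sum_stdVec, postcompCLM_laplacian, ← map_smul, ← map_sub, hG,
    SchwartzMap.postcompCLM_postcompCLM]
  ext x
  simp [SchwartzMap.postcompCLM_apply]

/-! ### `L¹` and `L²` estimates for the resolvent -/

section SchwartzEstimates

variable {ε : ℝ} {F G S T : 𝓢(E3, ℝ)}

theorem lineDerivOp_comm (S : 𝓢(E3, ℝ)) (i j : Fin 3) :
    ∂_{stdVec i} (∂_{stdVec j} S) = ∂_{stdVec j} (∂_{stdVec i} S) := by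
  ext x
  exact partialD_comm (S.smooth ⊤) i j x

theorem integrable_bdd_mul_schwartz (c : E3 →ᵇ ℝ) (S : 𝓢(E3, ℝ)) :
    Integrable fun x => c x * S x :=
  S.integrable.bdd_mul c.continuous.aestronglyMeasurable (.of_forall c.norm_coe_le_norm)

theorem integrable_schwartz_mul (S T : 𝓢(E3, ℝ)) : Integrable fun x => S x * T x :=
  integrable_bdd_mul_schwartz S.toBoundedContinuousFunction T

theorem integrable_schwartz_sq (S : 𝓢(E3, ℝ)) : Integrable fun x => S x ^ 2 := by
  simpa only [sq] using integrable_schwartz_mul S S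

theorem integral_schwartz_mul_lineDerivOp (S T : 𝓢(E3, ℝ)) (j : Fin 3) :
    ∫ x, S x * (∂_{stdVec j} T : 𝓢(E3, ℝ)) x = -∫ x, (∂_{stdVec j} S : 𝓢(E3, ℝ)) x * T x :=
  SchwartzMap.integral_mul_lineDerivOp_right_eq_neg_left S T (stdVec j)

/-- Squaring the equation gives `F² = ε² G² - 2 ε G ΔG + (ΔG)²`. The cross term integrates to `2 ε ∫
|∇G|²`, and the term in `G²` is dropped. -/
theorem sum_integral_sq_le_integral_sq_resolvent
    (h : ε • G - ∑ j, ∂_{stdVec j} (∂_{stdVec j} G) = F) :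
    2 * ε * (∑ j, ∫ x, (∂_{stdVec j} G : 𝓢(E3, ℝ)) x ^ 2)
      + ∫ x, (∑ j, ∂_{stdVec j} (∂_{stdVec j} G) : 𝓢(E3, ℝ)) x ^ 2 ≤ ∫ x, F x ^ 2 := by
  set L : 𝓢(E3, ℝ) := ∑ j, ∂_{stdVec j} (∂_{stdVec j} G) with hL
  have hcross : ∫ x, G x * L x = -∑ j, ∫ x, (∂_{stdVec j} G : 𝓢(E3, ℝ)) x ^ 2 := by
    have h1 : ∀ x, G x * L x
        = ∑ j, G x * (∂_{stdVec j} (∂_{stdVec j} G) : 𝓢(E3, ℝ)) x := fun x => by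
      rw [hL, sum_apply, Finset.mul_sum]
    simp_rw [h1]
    rw [integral_finsetSum _ fun j _ => integrable_schwartz_mul _ _, ← Finset.sum_neg_distrib]
    refine Finset.sum_congr rfl fun j _ => ?_
    rw [integral_schwartz_mul_lineDerivOp]
    simp_rw [sq]
  have hF : ∀ x, F x ^ 2 = ε ^ 2 * G x ^ 2 - 2 * ε * (G x * L x) + L x ^ 2 := fun x => by
    rw [← h, sub_apply, smul_apply, smul_eq_mul]
    ring
  simp_rw [hF]
  rw [integral_add, integral_sub, integral_const_mul, integral_const_mul, hcross]
  · have : 0 ≤ ε ^ 2 * ∫ x, G x ^ 2 :=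
      mul_nonneg (sq_nonneg _) (integral_nonneg fun x => sq_nonneg _)
    rw [mul_neg, sub_neg_eq_add]
    exact add_le_add_left (le_add_of_nonneg_left this) _
  · exact (integrable_schwartz_sq G).const_mul _
  · exact (integrable_schwartz_mul G L).const_mul _
  · exact ((integrable_schwartz_sq G).const_mul _).sub ((integrable_schwartz_mul G L).const_mul _)
  · exact integrable_schwartz_sq L

theorem integral_sq_laplacian_le_of_resolvent (hε : 0 ≤ ε)
    (h : ε • G - ∑ j, ∂_{stdVec j} (∂_{stdVec j} G) = F) :
    ∫ x, (∑ j, ∂_{stdVec j} (∂_{stdVec j} G) : 𝓢(E3, ℝ)) x ^ 2 ≤ ∫ x, F x ^ 2 := by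
  have h1 := sum_integral_sq_le_integral_sq_resolvent h
  have h2 : 0 ≤ 2 * ε * ∑ j, ∫ x, (∂_{stdVec j} G : 𝓢(E3, ℝ)) x ^ 2 :=
    mul_nonneg (by positivity) (Finset.sum_nonneg fun j _ => integral_nonneg fun x => sq_nonneg _)
  exact (le_add_of_nonneg_left h2).trans h1

theorem integral_sq_lineDerivOp_le_of_resolvent (hε : 0 ≤ ε)
    (h : ε • G - ∑ j, ∂_{stdVec j} (∂_{stdVec j} G) = F) (i : Fin 3) :
    ε * ∫ x, (∂_{stdVec i} G : 𝓢(E3, ℝ)) x ^ 2 ≤ ∫ x, F x ^ 2 := by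
  have h1 := sum_integral_sq_le_integral_sq_resolvent h
  have h0 : ∀ j, 0 ≤ ∫ x, (∂_{stdVec j} G : 𝓢(E3, ℝ)) x ^ 2 :=
    fun j => integral_nonneg fun x => sq_nonneg _
  have h2 : ε * ∫ x, (∂_{stdVec i} G : 𝓢(E3, ℝ)) x ^ 2
      ≤ ε * ∑ j, ∫ x, (∂_{stdVec j} G : 𝓢(E3, ℝ)) x ^ 2 :=
    mul_le_mul_of_nonneg_left (Finset.single_le_sum (fun j _ => h0 j) (Finset.mem_univ i)) hε
  have h3 : 0 ≤ ε * ∑ j, ∫ x, (∂_{stdVec j} G : 𝓢(E3, ℝ)) x ^ 2 :=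
    mul_nonneg hε (Finset.sum_nonneg fun j _ => h0 j)
  have h4 : 0 ≤ ∫ x, (∑ j, ∂_{stdVec j} (∂_{stdVec j} G) : 𝓢(E3, ℝ)) x ^ 2 :=
    integral_nonneg fun x => sq_nonneg _
  calc _ ≤ _ := h2
    _ ≤ 2 * ε * ∑ j, ∫ x, (∂_{stdVec j} G : 𝓢(E3, ℝ)) x ^ 2 := by
      rw [mul_assoc, two_mul]
      exact le_add_of_nonneg_left h3
    _ ≤ _ := (le_add_of_nonneg_right h4).trans h1

/-- Second derivatives are controlled by the Laplacian in `L²`. -/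
theorem integral_sq_lineDerivOp_lineDerivOp_le (S : 𝓢(E3, ℝ)) (i j : Fin 3) :
    ∫ x, (∂_{stdVec i} (∂_{stdVec j} S) : 𝓢(E3, ℝ)) x ^ 2
      ≤ ∫ x, (∑ k, ∂_{stdVec k} (∂_{stdVec k} S) : 𝓢(E3, ℝ)) x ^ 2 := by
  -- Integrating by parts twice and commuting derivatives moves one `k` and one `l` across; summed
  -- over `k` and `l`, this makes the `L²` norms of the Hessian and of the Laplacian equal.
  have hsym : ∀ k l, ∫ x, (∂_{stdVec k} (∂_{stdVec l} S) : 𝓢(E3, ℝ)) x ^ 2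
      = ∫ x, (∂_{stdVec k} (∂_{stdVec k} S) : 𝓢(E3, ℝ)) x
          * (∂_{stdVec l} (∂_{stdVec l} S) : 𝓢(E3, ℝ)) x := fun k l => by
    simp_rw [sq]
    rw [integral_schwartz_mul_lineDerivOp, lineDerivOp_comm S k l,
      lineDerivOp_comm _ k l, integral_schwartz_mul_lineDerivOp _ (∂_{stdVec l} S) l]
  have hnn : ∀ k l, 0 ≤ ∫ x, (∂_{stdVec k} (∂_{stdVec l} S) : 𝓢(E3, ℝ)) x ^ 2 :=
    fun k l => integral_nonneg fun x => sq_nonneg _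
  have hsum : ∫ x, (∑ k, ∂_{stdVec k} (∂_{stdVec k} S) : 𝓢(E3, ℝ)) x ^ 2
      = ∑ k, ∑ l, ∫ x, (∂_{stdVec k} (∂_{stdVec l} S) : 𝓢(E3, ℝ)) x ^ 2 := by
    simp_rw [hsym, sum_apply, sq, Finset.sum_mul_sum]
    rw [integral_finsetSum _ fun k _ => integrable_finsetSum _ fun l _ =>
      integrable_schwartz_mul _ _]
    exact Finset.sum_congr rfl fun k _ =>
      integral_finsetSum _ fun l _ => integrable_schwartz_mul _ _
  rw [hsum]
  exact (Finset.single_le_sum (f := fun l => ∫ x, (∂_{stdVec i} (∂_{stdVec l} S) : 𝓢(E3, ℝ)) x ^ 2)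
    (fun l _ => hnn i l) (Finset.mem_univ j)).trans
    (Finset.single_le_sum (f := fun k => ∑ l, ∫ x, (∂_{stdVec k} (∂_{stdVec l} S) : 𝓢(E3, ℝ)) x ^ 2)
      (fun k _ => Finset.sum_nonneg fun l _ => hnn k l) (Finset.mem_univ i))

/-- Testing the resolvent equation with a bounded monotone function of the solution. -/
theorem integral_mul_arctan_le_of_resolvent
    (h : ε • G - ∑ j, ∂_{stdVec j} (∂_{stdVec j} G) = F) {t : ℝ} (ht : 0 ≤ t) :
    ε * ∫ x, G x * Real.arctan (t * G x) ≤ Real.pi / 2 * ∫ x, |F x| := by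
  have hbdd : ∀ y, ‖Real.arctan y‖ ≤ Real.pi / 2 := fun y => by
    rw [Real.norm_eq_abs, abs_le]
    exact ⟨by linarith [Real.neg_pi_div_two_lt_arctan y], (Real.arctan_lt_pi_div_two y).le⟩
  have hcont : Continuous fun x => Real.arctan (t * G x) :=
    Real.continuous_arctan.comp (G.continuous.const_mul t)
  have hint : ∀ S : 𝓢(E3, ℝ), Integrable fun x => Real.arctan (t * G x) * S x := fun S =>
    S.integrable.bdd_mul hcont.aestronglyMeasurable (.of_forall fun x => hbdd _)
  have hderiv : ∀ x, HasFDerivAt (fun x => Real.arctan (t * G x))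
      ((1 / (1 + (t * G x) ^ 2)) • t • fderiv ℝ G x) x := fun x =>
    ((G.hasFDerivAt x).const_mul t).arctan
  -- Since `arctan` is increasing, integration by parts leaves minus the integral of `t (∂ⱼG)² / (1
  -- + t² G²)`.
  have hpart : ∀ j, ∫ x, Real.arctan (t * G x) *
      (∂_{stdVec j} (∂_{stdVec j} G) : 𝓢(E3, ℝ)) x ≤ 0 := by
    intro j
    have hd : ∀ x, fderiv ℝ (fun x => Real.arctan (t * G x)) x (stdVec j)
        = 1 / (1 + (t * G x) ^ 2) * t * (∂_{stdVec j} G : 𝓢(E3, ℝ)) x := fun x => by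
      rw [(hderiv x).fderiv, SchwartzMap.lineDerivOp_apply_eq_fderiv]
      simp only [smul_apply, smul_eq_mul]
      ring
    have h1 := integral_mul_fderiv_eq_neg_fderiv_mul_of_integrable (μ := volume)
      (f := fun x => Real.arctan (t * G x)) (g := (∂_{stdVec j} G : 𝓢(E3, ℝ))) (v := stdVec j)
      ?_ (hint (∂_{stdVec j} (∂_{stdVec j} G))) (hint _)
      (fun x _ => (hderiv x).differentiableAt) (fun x _ => SchwartzMap.differentiableAt _)
    · change ∫ x, Real.arctan (t * G x) * fderiv ℝ (∂_{stdVec j} G : 𝓢(E3, ℝ)) x (stdVec j) ≤ 0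
      rw [h1, neg_nonpos]
      refine integral_nonneg fun x => ?_
      rw [hd, mul_assoc]
      exact mul_nonneg (by positivity) (mul_self_nonneg _)
    · simp_rw [hd, mul_assoc]
      refine ((integrable_schwartz_mul (∂_{stdVec j} G) (∂_{stdVec j} G)).const_mul t).bdd_mul
        (c := 1) ?_ (.of_forall fun x => ?_)
      · refine Continuous.aestronglyMeasurable (.div₀ continuous_const ?_ fun x => ?_)
        · exact continuous_const.add ((G.continuous.const_mul t).pow 2)
        · positivity
      · rw [Real.norm_of_nonneg (by positivity)]
        exact div_le_one_of_le₀ (by nlinarith [sq_nonneg (t * G x)]) (by positivity)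
  have hid : ∀ x, ε * (G x * Real.arctan (t * G x)) = Real.arctan (t * G x) * F x
      + ∑ j, Real.arctan (t * G x) * (∂_{stdVec j} (∂_{stdVec j} G) : 𝓢(E3, ℝ)) x := fun x => by
    rw [← h, sub_apply, smul_apply, smul_eq_mul, sum_apply, ← Finset.mul_sum]
    ring
  rw [← integral_const_mul]
  simp_rw [hid]
  rw [integral_add (hint F) (integrable_finsetSum _ fun j _ => hint _),
    integral_finsetSum _ fun j _ => hint _]
  have h2 : ∫ x, Real.arctan (t * G x) * F x ≤ Real.pi / 2 * ∫ x, |F x| := by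
    rw [← integral_const_mul]
    refine integral_mono (hint F) (F.integrable.abs.const_mul _) fun x => ?_
    refine (le_abs_self _).trans ?_
    rw [abs_mul]
    exact mul_le_mul_of_nonneg_right (hbdd _) (abs_nonneg _)
  linarith [Finset.sum_nonpos fun j (_ : j ∈ Finset.univ) => hpart j]

theorem mul_arctan_tendsto (a : ℝ) :
    Tendsto (fun n : ℕ => a * Real.arctan (n * a)) atTop (𝓝 (Real.pi / 2 * |a|)) := by
  have hpos : ∀ b : ℝ, 0 < b →
      Tendsto (fun n : ℕ => b * Real.arctan (n * b)) atTop (𝓝 (Real.pi / 2 * b)) := fun b hb => by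
    rw [mul_comm]
    exact ((Real.tendsto_arctan_atTop.mono_right nhdsWithin_le_nhds).comp
      (tendsto_natCast_atTop_atTop.atTop_mul_const hb)).const_mul b
  rcases lt_trichotomy a 0 with ha | rfl | ha
  · rw [abs_of_neg ha]
    refine (hpos (-a) (by linarith)).congr fun n => ?_
    rw [mul_neg, Real.arctan_neg]
    ring
  · simp
  · rw [abs_of_pos ha]
    exact hpos a ha

/-- The resolvent is a contraction in `L¹`, up to the factor `ε`. -/
theorem integral_abs_le_of_resolvent
    (h : ε • G - ∑ j, ∂_{stdVec j} (∂_{stdVec j} G) = F) :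
    ε * ∫ x, |G x| ≤ ∫ x, |F x| := by
  -- `arctan (n G)` is a smooth substitute for `π/2` times the sign of `G`; the resolvent kernel is
  -- not needed.
  have hlim : Tendsto (fun n : ℕ => ∫ x, G x * Real.arctan (n * G x)) atTop
      (𝓝 (∫ x, Real.pi / 2 * |G x|)) := by
    refine tendsto_integral_of_dominated_convergence (fun x => Real.pi / 2 * |G x|)
      (fun n => ?_) (G.integrable.abs.const_mul _) (fun n => .of_forall fun x => ?_)
      (.of_forall fun x => mul_arctan_tendsto _)
    · exact (G.continuous.mul (Real.continuous_arctan.comp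
        (G.continuous.const_mul _))).aestronglyMeasurable
    · rw [norm_mul, mul_comm, Real.norm_eq_abs, Real.norm_eq_abs]
      refine mul_le_mul_of_nonneg_right (abs_le.2 ⟨?_, ?_⟩) (abs_nonneg _)
      · linarith [Real.neg_pi_div_two_lt_arctan (n * G x)]
      · exact (Real.arctan_lt_pi_div_two _).le
  have hle := le_of_tendsto (hlim.const_mul ε)
    (.of_forall fun n => integral_mul_arctan_le_of_resolvent h n.cast_nonneg)
  rw [integral_const_mul] at hle
  have hpi : 0 < Real.pi / 2 := by positivity
  refine le_of_mul_le_mul_left (a := Real.pi / 2) ?_ hpi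
  linarith

/-- Derivatives of solutions of the resolvent equation, multiplied by the spectral parameter, tend
to zero weakly against functions in `L⁴`. -/
theorem exists_abs_integralAgainst_resolvent_le (c : E3 →ᵇ ℝ)
    (hc : Integrable fun x => c x ^ 4) (F : 𝓢(E3, ℝ)) (j : Fin 3) :
    ∃ C, ∀ η : ℝ, 0 < η → ∀ G : 𝓢(E3, ℝ),
      η ^ 4 • G - ∑ k, ∂_{stdVec k} (∂_{stdVec k} G) = F →
        |η ^ 4 * integralAgainst c (∂_{stdVec j} G)| ≤ C * η := by
  set A := ∫ x, c x ^ 4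
  set K₁ := ∫ x, |(∂_{stdVec j} F : 𝓢(E3, ℝ)) x|
  set K₂ := ∫ x, F x ^ 2
  refine ⟨K₁ + A / 2 + K₂ / 2, fun η hη G hG => ?_⟩
  -- `∂ⱼG` solves the resolvent equation with datum `∂ⱼF`. Hence `η⁴ ‖∂ⱼG‖₁ ≤ ‖∂ⱼF‖₁`, while the
  -- energy estimate for `G` gives `η⁴ ‖∂ⱼG‖₂² ≤ ‖F‖₂²`.
  have hdG : η ^ 4 • (∂_{stdVec j} G) - ∑ k, ∂_{stdVec k} (∂_{stdVec k} (∂_{stdVec j} G))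
      = ∂_{stdVec j} F := by
    rw [← hG, sub_eq_add_neg, sub_eq_add_neg, LineDeriv.lineDerivOp_add,
      LineDeriv.lineDerivOp_smul, LineDeriv.lineDerivOp_neg, LineDeriv.lineDerivOp_sum]
    congr 2
    refine Finset.sum_congr rfl fun k _ => ?_
    rw [lineDerivOp_comm G k j, lineDerivOp_comm _ k j]
  have h1 := integral_abs_le_of_resolvent hdG
  have h2 := integral_sq_lineDerivOp_le_of_resolvent (by positivity) hG j
  set a : 𝓢(E3, ℝ) := ∂_{stdVec j} G
  have hpt : ∀ x, |η ^ 4 * (c x * a x)|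
      ≤ η * (η ^ 4 * |a x|) + (η / 2 * c x ^ 4 + η ^ 5 / 2 * a x ^ 2) := fun x => by
    -- This splits `c` into a part of size `η`, paired with the `L¹` bound, and a part `c² / η` in
    -- `L²`, paired with the `L²` bound. Taking the spectral parameter to be `η⁴` makes both
    -- contributions `O(η)`.
    have e1 : |c x| ≤ η + c x ^ 2 / η := by
      rw [← sq_abs, ← sub_nonneg]
      have : η + |c x| ^ 2 / η - |c x| = (η ^ 2 + |c x| ^ 2 - η * |c x|) / η := by
        field_simp
      rw [this]
      exact div_nonneg (by nlinarith [sq_nonneg (η - |c x|), abs_nonneg (c x)]) hη.le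
    rw [abs_mul, abs_mul, abs_of_pos (by positivity : 0 < η ^ 4)]
    calc η ^ 4 * (|c x| * |a x|) ≤ η ^ 4 * ((η + c x ^ 2 / η) * |a x|) := by gcongr
      _ = η * (η ^ 4 * |a x|) + η ^ 3 * (c x ^ 2 * |a x|) := by field_simp
      _ ≤ _ := by
        rw [← sq_abs (a x)]
        have : 0 ≤ η / 2 * (c x ^ 2 - η ^ 2 * |a x|) ^ 2 := by positivity
        nlinarith
  have hi1 : Integrable fun x => η * (η ^ 4 * |a x|) :=
    (a.integrable.abs.const_mul _).const_mul _
  have hi2 : Integrable fun x => η / 2 * c x ^ 4 := hc.const_mul _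
  have hi3 : Integrable fun x => η ^ 5 / 2 * a x ^ 2 := (integrable_schwartz_sq a).const_mul _
  have hi23 : Integrable fun x => η / 2 * c x ^ 4 + η ^ 5 / 2 * a x ^ 2 := hi2.add hi3
  rw [integralAgainst_apply, ← integral_const_mul]
  calc |∫ x, η ^ 4 * (c x * a x)| ≤ ∫ x, |η ^ 4 * (c x * a x)| := abs_integral_le_integral_abs
    _ ≤ ∫ x, (η * (η ^ 4 * |a x|) + (η / 2 * c x ^ 4 + η ^ 5 / 2 * a x ^ 2)) :=
      integral_mono ((integrable_bdd_mul_schwartz c a).const_mul _).abs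
        (hi1.add hi23) hpt
    _ = η * (η ^ 4 * ∫ x, |a x|) + (η / 2 * A + η / 2 * (η ^ 4 * ∫ x, a x ^ 2)) := by
      rw [integral_add hi1 hi23, integral_add hi2 hi3]
      simp_rw [integral_const_mul]
      ring
    _ ≤ η * K₁ + (η / 2 * A + η / 2 * K₂) := by gcongr
    _ = _ := by ring

end SchwartzEstimates

/-! ### The weak momentum form and elimination of the pressure -/

/-- The weak form `∫ u · ΔV + f : ∇V + w · (∇ × V)` of the stationary momentum equation as a
functional of the test field `V`. -/
noncomputable def weakForm (u w : Fin 3 → E3 →ᵇ ℝ) (f : Fin 3 → Fin 3 → E3 →ᵇ ℝ)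
    (V : Fin 3 → 𝓢(E3, ℝ)) : ℝ :=
  ∑ i, ∑ j, (integralAgainst (u i) (∂_{stdVec j} (∂_{stdVec j} (V i)))
      + integralAgainst (f i j) (∂_{stdVec j} (V i)))
    + (integralAgainst (w 0) (∂_{stdVec 1} (V 2)) - integralAgainst (w 0) (∂_{stdVec 2} (V 1)))
    + (integralAgainst (w 1) (∂_{stdVec 2} (V 0)) - integralAgainst (w 1) (∂_{stdVec 0} (V 2)))
    + (integralAgainst (w 2) (∂_{stdVec 0} (V 1)) - integralAgainst (w 2) (∂_{stdVec 1} (V 0)))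

/-- The field `∇ × (∇ × H) = ∇ (∇ · H) - Δ H`. -/
noncomputable def curlCurl (H : Fin 3 → 𝓢(E3, ℝ)) (i : Fin 3) : 𝓢(E3, ℝ) :=
  ∂_{stdVec i} (∑ j, ∂_{stdVec j} (H j)) - ∑ j, ∂_{stdVec j} (∂_{stdVec j} (H i))

section projection

variable {u w : Fin 3 → E3 →ᵇ ℝ} {f : Fin 3 → Fin 3 → E3 →ᵇ ℝ}

theorem lineDerivOp_schwartz_sub (S T : 𝓢(E3, ℝ)) (v : E3) : ∂_{v} (S - T) = ∂_{v} S - ∂_{v} T :=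
  map_sub (LineDeriv.lineDerivOpCLM ℝ 𝓢(E3, ℝ) v) S T

theorem continuous_lineDerivOp (v : E3) : Continuous fun S : 𝓢(E3, ℝ) => ∂_{v} S :=
  (LineDeriv.lineDerivOpCLM ℝ 𝓢(E3, ℝ) v).continuous

theorem weakForm_sub (V V' : Fin 3 → 𝓢(E3, ℝ)) :
    weakForm u w f (fun i => V i - V' i) = weakForm u w f V - weakForm u w f V' := by
  simp only [weakForm, lineDerivOp_schwartz_sub, map_sub, Finset.sum_add_distrib, Finset.sum_sub_distrib]
  ring

theorem weakForm_smul (c : ℝ) (V : Fin 3 → 𝓢(E3, ℝ)) :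
    weakForm u w f (fun i => c • V i) = c * weakForm u w f V := by
  simp only [weakForm, LineDeriv.lineDerivOp_smul, map_smul, smul_eq_mul, mul_add,
    Finset.sum_add_distrib, Finset.mul_sum, mul_sub]

theorem continuous_weakForm : Continuous (weakForm u w f) := by
  have h1 : ∀ (c : E3 →ᵇ ℝ) (i j : Fin 3),
      Continuous fun V : Fin 3 → 𝓢(E3, ℝ) => integralAgainst c (∂_{stdVec j} (V i)) :=
    fun c i j => (integralAgainst c).continuous.comp
      ((continuous_lineDerivOp _).comp (continuous_apply i))
  have h2 : ∀ (c : E3 →ᵇ ℝ) (i j : Fin 3), Continuous fun V : Fin 3 → 𝓢(E3, ℝ) =>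
      integralAgainst c (∂_{stdVec j} (∂_{stdVec j} (V i))) :=
    fun c i j => (integralAgainst c).continuous.comp
      ((continuous_lineDerivOp _).comp ((continuous_lineDerivOp _).comp (continuous_apply i)))
  unfold weakForm
  exact (((continuous_finsetSum _ fun i _ => continuous_finsetSum _ fun j _ =>
    (h2 _ i j).add (h1 _ i j)).add ((h1 _ _ _).sub (h1 _ _ _))).add
    ((h1 _ _ _).sub (h1 _ _ _))).add ((h1 _ _ _).sub (h1 _ _ _))

theorem continuous_curlCurl : Continuous curlCurl := by
  refine continuous_pi fun i => Continuous.sub ?_ ?_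
  · exact (continuous_lineDerivOp _).comp (continuous_finsetSum _ fun j _ =>
      (continuous_lineDerivOp _).comp (continuous_apply j))
  · exact continuous_finsetSum _ fun j _ =>
      (continuous_lineDerivOp _).comp ((continuous_lineDerivOp _).comp (continuous_apply i))

theorem sum_lineDerivOp_curlCurl (H : Fin 3 → 𝓢(E3, ℝ)) :
    ∑ i, ∂_{stdVec i} (curlCurl H i) = 0 := by
  simp only [curlCurl, lineDerivOp_schwartz_sub, LineDeriv.lineDerivOp_sum, Finset.sum_sub_distrib]
  rw [sub_eq_zero, Finset.sum_comm]
  refine Finset.sum_congr rfl fun j _ => Finset.sum_congr rfl fun i _ => ?_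
  rw [lineDerivOp_comm (H j) i j, lineDerivOp_comm _ i j]

theorem hasCompactSupport_lineDerivOp {S : 𝓢(E3, ℝ)} (hS : HasCompactSupport S) (j : Fin 3) :
    HasCompactSupport (∂_{stdVec j} S : 𝓢(E3, ℝ)) :=
  HasCompactSupport.partialD hS j

theorem hasCompactSupport_schwartz_add {S T : 𝓢(E3, ℝ)} (hS : HasCompactSupport S)
    (hT : HasCompactSupport T) : HasCompactSupport (S + T : 𝓢(E3, ℝ)) :=
  HasCompactSupport.add hS hT

theorem hasCompactSupport_schwartz_sub {S T : 𝓢(E3, ℝ)} (hS : HasCompactSupport S)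
    (hT : HasCompactSupport T) : HasCompactSupport (S - T : 𝓢(E3, ℝ)) :=
  HasCompactSupport.sub hS hT

theorem hasCompactSupport_schwartz_sum {S : Fin 3 → 𝓢(E3, ℝ)}
    (hS : ∀ i, HasCompactSupport (S i)) : HasCompactSupport (∑ i, S i : 𝓢(E3, ℝ)) := by
  rw [Fin.sum_univ_three]
  exact hasCompactSupport_schwartz_add (hasCompactSupport_schwartz_add (hS 0) (hS 1)) (hS 2)

theorem hasCompactSupport_curlCurl {H : Fin 3 → 𝓢(E3, ℝ)} (hH : ∀ i, HasCompactSupport (H i))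
    (i : Fin 3) : HasCompactSupport (curlCurl H i) :=
  hasCompactSupport_schwartz_sub
    (hasCompactSupport_lineDerivOp
      (hasCompactSupport_schwartz_sum fun j => hasCompactSupport_lineDerivOp (hH j) j) i)
    (hasCompactSupport_schwartz_sum fun j =>
      hasCompactSupport_lineDerivOp (hasCompactSupport_lineDerivOp (hH i) j) j)

/-- The solution of the resolvent equation is a Schwartz function but need not have compact support.
The double curl preserves compact support and is solenoidal, so the vanishing extends by density and
continuity. -/
theorem weakForm_curlCurl
    (hweak : ∀ V : Fin 3 → 𝓢(E3, ℝ), (∀ i, HasCompactSupport (V i)) →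
      ∑ i, ∂_{stdVec i} (V i) = 0 → weakForm u w f V = 0)
    (H : Fin 3 → 𝓢(E3, ℝ)) : weakForm u w f (curlCurl H) = 0 := by
  have hd : Dense (Set.univ.pi fun _ : Fin 3 => {S : 𝓢(E3, ℝ) | HasCompactSupport S}) :=
    dense_pi _ fun _ _ => dense_hasCompactSupport
  have hc : IsClosed {H : Fin 3 → 𝓢(E3, ℝ) | weakForm u w f (curlCurl H) = 0} :=
    isClosed_eq (continuous_weakForm.comp continuous_curlCurl) continuous_const
  refine (hc.closure_subset_iff.2 fun H hH => ?_) (hd H)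
  exact hweak _ (hasCompactSupport_curlCurl fun i => hH i (Set.mem_univ i))
    (sum_lineDerivOp_curlCurl H)

theorem sum_integralAgainst_lineDerivOp_eq_zero
    (hdiv : ∀ S : 𝓢(E3, ℝ), HasCompactSupport S →
      ∑ i, integralAgainst (u i) (∂_{stdVec i} S) = 0)
    (S : 𝓢(E3, ℝ)) : ∑ i, integralAgainst (u i) (∂_{stdVec i} S) = 0 := by
  have hc : IsClosed {S : 𝓢(E3, ℝ) | ∑ i, integralAgainst (u i) (∂_{stdVec i} S) = 0} :=
    isClosed_eq (continuous_finsetSum _ fun i _ =>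
      (integralAgainst (u i)).continuous.comp (continuous_lineDerivOp _)) continuous_const
  exact (hc.closure_subset_iff.2 fun S hS => hdiv S hS) (dense_hasCompactSupport S)

/-- On gradients the weak form only sees the quadratic term. -/
theorem weakForm_gradient
    (hdiv : ∀ S : 𝓢(E3, ℝ), HasCompactSupport S →
      ∑ i, integralAgainst (u i) (∂_{stdVec i} S) = 0) (g : 𝓢(E3, ℝ)) :
    weakForm u w f (fun i => ∂_{stdVec i} g)
      = ∑ i, ∑ j, integralAgainst (f i j) (∂_{stdVec j} (∂_{stdVec i} g)) := by
  -- The viscous term pairs `u` with the gradient of `Δg` and vanishes because `u` is solenoidal.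
  -- The `w` terms cancel because the curl of a gradient is zero.
  have h1 : ∑ i, ∑ j, integralAgainst (u i) (∂_{stdVec j} (∂_{stdVec j} (∂_{stdVec i} g))) = 0 := by
    rw [← sum_integralAgainst_lineDerivOp_eq_zero hdiv (∑ j, ∂_{stdVec j} (∂_{stdVec j} g))]
    refine Finset.sum_congr rfl fun i _ => ?_
    rw [LineDeriv.lineDerivOp_sum, map_sum]
    refine Finset.sum_congr rfl fun j _ => ?_
    rw [lineDerivOp_comm g j i, lineDerivOp_comm _ j i]
  simp only [weakForm, Finset.sum_add_distrib, h1]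
  rw [lineDerivOp_comm g 1 2, lineDerivOp_comm g 2 0, lineDerivOp_comm g 0 1]
  ring

/-- Young's inequality; `t` stays free so that the fixed norm of `c` can later be given a small
weight. -/
theorem abs_integralAgainst_le {c : E3 →ᵇ ℝ} (hc : Integrable fun x => c x ^ 2) (S : 𝓢(E3, ℝ))
    {t : ℝ} (ht : 0 < t) :
    |integralAgainst c S| ≤ t * (∫ x, c x ^ 2) + t⁻¹ * ∫ x, S x ^ 2 := by
  have hi1 : Integrable fun x => t * c x ^ 2 := hc.const_mul _
  have hi2 : Integrable fun x => t⁻¹ * S x ^ 2 := (integrable_schwartz_sq S).const_mul _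
  rw [integralAgainst_apply, ← integral_const_mul, ← integral_const_mul, ← integral_add hi1 hi2]
  refine abs_integral_le_integral_abs.trans
    (integral_mono (integrable_bdd_mul_schwartz c S).abs (hi1.add hi2) fun x => ?_)
  have h1 : t * c x ^ 2 + t⁻¹ * S x ^ 2 - 2 * (|c x| * |S x|)
      = t⁻¹ * (t * |c x| - |S x|) ^ 2 := by
    rw [← sq_abs (c x), ← sq_abs (S x)]
    field_simp
    ring
  have h2 : 0 ≤ t⁻¹ * (t * |c x| - |S x|) ^ 2 := by positivity
  have h3 : 0 ≤ |c x| * |S x| := by positivity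
  change |c x * S x| ≤ t * c x ^ 2 + t⁻¹ * S x ^ 2
  rw [abs_mul]
  linarith

/-- If the weak form vanishes on solenoidal test fields, then on a general test field it is
controlled by the divergence of the test field: the pressure is as good as the quadratic term. -/
theorem abs_weakForm_le (hu : ∀ i, Integrable fun x => u i x ^ 4)
    (hw : ∀ i, Integrable fun x => w i x ^ 4) (hf : ∀ i j, Integrable fun x => f i j x ^ 4)
    (hf2 : ∀ i j, Integrable fun x => f i j x ^ 2)
    (hdiv : ∀ S : 𝓢(E3, ℝ), HasCompactSupport S →
      ∑ i, integralAgainst (u i) (∂_{stdVec i} S) = 0)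
    (hweak : ∀ V : Fin 3 → 𝓢(E3, ℝ), (∀ i, HasCompactSupport (V i)) →
      ∑ i, ∂_{stdVec i} (V i) = 0 → weakForm u w f V = 0)
    (F : Fin 3 → 𝓢(E3, ℝ)) {t : ℝ} (ht : 0 < t) :
    |weakForm u w f F| ≤ t * (∑ i, ∑ j, ∫ x, f i j x ^ 2)
      + 9 * t⁻¹ * ∫ x, (∑ i, ∂_{stdVec i} (F i) : 𝓢(E3, ℝ)) x ^ 2 := by
  set h : 𝓢(E3, ℝ) := ∑ i, ∂_{stdVec i} (F i) with hh
  set B := t * (∑ i, ∑ j, ∫ x, f i j x ^ 2) + 9 * t⁻¹ * ∫ x, h x ^ 2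
  choose Cu hCu using fun i j => exists_abs_integralAgainst_resolvent_le (u i) (hu i)
    (∂_{stdVec j} (F i)) j
  choose Cf hCf using fun i j => exists_abs_integralAgainst_resolvent_le (f i j) (hf i j) (F i) j
  choose Cw hCw using fun k i j => exists_abs_integralAgainst_resolvent_le (w k) (hw k) (F i) j
  set C := ∑ i, ∑ j, (Cu i j + Cf i j) + (Cw 0 2 1 + Cw 0 1 2) + (Cw 1 0 2 + Cw 1 2 0)
    + (Cw 2 1 0 + Cw 2 0 1)
  have key : ∀ η : ℝ, 0 < η → |weakForm u w f F| ≤ C * η + B := by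
    intro η hη
    choose G hG using fun i => exists_resolvent (pow_pos hη 4) (F i)
    set g : 𝓢(E3, ℝ) := ∑ j, ∂_{stdVec j} (G j) with hg
    have hdG : ∀ i j, η ^ 4 • (∂_{stdVec j} (G i))
        - ∑ k, ∂_{stdVec k} (∂_{stdVec k} (∂_{stdVec j} (G i))) = ∂_{stdVec j} (F i) := by
      intro i j
      rw [← hG, lineDerivOp_schwartz_sub, LineDeriv.lineDerivOp_smul, LineDeriv.lineDerivOp_sum]
      congr 1
      refine Finset.sum_congr rfl fun k _ => ?_
      rw [lineDerivOp_comm (G i) k j, lineDerivOp_comm _ k j]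
    -- Taking the divergence of the equations for `G` shows that `g` solves the resolvent equation
    -- with datum `div F`, so its Hessian is bounded in `L²` uniformly in `η`.
    have hgres : η ^ 4 • g - ∑ k, ∂_{stdVec k} (∂_{stdVec k} g) = h := by
      simp only [hg, hh, Finset.smul_sum, ← hdG, Finset.sum_sub_distrib, LineDeriv.lineDerivOp_sum]
      rw [Finset.sum_comm]
    -- An approximate Helmholtz decomposition: `curl curl G = ∇g - ΔG` and `-ΔG = F - η⁴ G`.
    have hsplit : weakForm u w f F
        = η ^ 4 * weakForm u w f G - weakForm u w f fun i => ∂_{stdVec i} g := by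
      have h1 := weakForm_curlCurl hweak G
      have h2 : curlCurl G = fun i => F i - (η ^ 4 • G i - ∂_{stdVec i} g) := by
        funext i
        rw [curlCurl, ← hg, ← hG i]
        abel
      rw [h2, weakForm_sub, weakForm_sub, weakForm_smul] at h1
      linarith
    -- Every term of the weak form carries a derivative of the test field. In the viscous term,
    -- which has two, the inner one is absorbed by using datum `∂ⱼFᵢ`.
    have hfirst : |η ^ 4 * weakForm u w f G| ≤ C * η := by
      simp only [weakForm, mul_add, mul_sub, Finset.mul_sum, C, add_mul, Finset.sum_mul]
      refine (abs_add_le _ _).trans (add_le_add ((abs_add_le _ _).trans (add_le_add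
        ((abs_add_le _ _).trans (add_le_add ?_ ?_)) ?_)) ?_)
      · refine (Finset.abs_sum_le_sum_abs _ _).trans (Finset.sum_le_sum fun i _ =>
          (Finset.abs_sum_le_sum_abs _ _).trans (Finset.sum_le_sum fun j _ =>
            (abs_add_le _ _).trans (add_le_add ?_ ?_)))
        · exact hCu i j η hη _ (hdG i j)
        · exact hCf i j η hη _ (hG i)
      all_goals
        exact (abs_sub _ _).trans (add_le_add (hCw _ _ _ η hη _ (hG _)) (hCw _ _ _ η hη _ (hG _)))
    have hsecond : |weakForm u w f fun i => ∂_{stdVec i} g| ≤ B := by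
      rw [weakForm_gradient hdiv]
      have hterm : ∀ i j, |integralAgainst (f i j) (∂_{stdVec j} (∂_{stdVec i} g))|
          ≤ t * (∫ x, f i j x ^ 2) + t⁻¹ * ∫ x, h x ^ 2 := fun i j =>
        (abs_integralAgainst_le (hf2 i j) _ ht).trans (add_le_add le_rfl
          (mul_le_mul_of_nonneg_left ((integral_sq_lineDerivOp_lineDerivOp_le g j i).trans
            (integral_sq_laplacian_le_of_resolvent (by positivity) hgres)) (by positivity)))
      calc _ ≤ ∑ i, ∑ j, |integralAgainst (f i j) (∂_{stdVec j} (∂_{stdVec i} g))| :=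
            (Finset.abs_sum_le_sum_abs _ _).trans (Finset.sum_le_sum fun i _ =>
              Finset.abs_sum_le_sum_abs _ _)
        -- The nine index pairs account for the constant `9`.
        _ ≤ ∑ i : Fin 3, ∑ j : Fin 3, (t * (∫ x, f i j x ^ 2) + t⁻¹ * ∫ x, h x ^ 2) :=
            Finset.sum_le_sum fun i _ => Finset.sum_le_sum fun j _ => hterm i j
        _ = B := by
            simp only [Finset.sum_add_distrib, ← Finset.mul_sum, Finset.sum_const,
              Finset.card_univ, Fintype.card_fin, nsmul_eq_mul, B]
            push_cast
            ring
    rw [hsplit]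
    exact (abs_sub _ _).trans (add_le_add hfirst hsecond)
  have hlim : Tendsto (fun η : ℝ => C * η + B) (𝓝[>] 0) (𝓝 (C * 0 + B)) :=
    ((continuous_const.mul continuous_id).add continuous_const).continuousAt.tendsto.mono_left
      nhdsWithin_le_nhds
  rw [mul_zero, zero_add] at hlim
  exact ge_of_tendsto hlim (eventually_nhdsWithin_of_forall fun η hη => key η hη)

end projection

/-! ### The local energy inequality -/

section energy

variable {f g : E3 → ℝ} {u v w b : Fin 3 → E3 → ℝ} {x : E3}

theorem partialD_partialD_mul (hf : ContDiff ℝ ∞ f) (hg : ContDiff ℝ ∞ g) (i j : Fin 3) (x : E3) :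
    partialD i (partialD j fun y => f y * g y) x
      = f x * partialD i (partialD j g) x + partialD i f x * partialD j g x
        + (g x * partialD i (partialD j f) x + partialD i g x * partialD j f x) := by
  have h : (partialD j fun y => f y * g y)
      = fun y => f y * partialD j g y + g y * partialD j f y := funext fun y => partialD_mul hf hg
  rw [h, partialD_add (hf.mul (hg.partialD j)) (hg.mul (hf.partialD j)),
    partialD_mul hf (hg.partialD j), partialD_mul hg (hf.partialD j)]
  ring

theorem sum_mul_laplacian (hv : ∀ i, ContDiff ℝ ∞ (v i)) :
    ∑ i, v i x * ∑ j, partialD j (partialD j (v i)) x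
      = 1 / 2 * ∑ i, ∑ j, partialD j (partialD j fun y => v i y * v i y) x
        - ∑ i, ∑ j, partialD j (v i) x ^ 2 := by
  simp only [partialD_partialD_mul (hv _) (hv _), Fin.sum_univ_three]
  ring

/-- Expanding `∂ᵢ∂ⱼ(wᵢ wⱼ)` symmetrically avoids a flux containing `div w`: only products of
undifferentiated components remain under the derivatives, so quadratic growth bounds suffice. -/
theorem sum_mul_gradient_divergence (hw : ∀ i, ContDiff ℝ ∞ (w i)) :
    ∑ i, w i x * partialD i (fun y => ∑ j, partialD j (w j) y) x
      = 1 / 2 * ∑ i, ∑ j, partialD i (partialD j fun y => w i y * w j y) x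
        - 1 / 2 * (∑ i, ∑ j, partialD i (w j) x * partialD j (w i) x
          + (∑ i, partialD i (w i) x) ^ 2) := by
  have hd : ∀ i, partialD i (fun y => ∑ j, partialD j (w j) y) x
      = ∑ j, partialD i (partialD j (w j)) x := fun i =>
    partialD_sum Finset.univ fun k => (hw k).partialD k
  simp_rw [hd]
  simp only [partialD_partialD_mul (hw _) (hw _), Fin.sum_univ_three]
  rw [partialD_comm (hw 0) 1 0, partialD_comm (hw 0) 2 0, partialD_comm (hw 1) 0 1,
    partialD_comm (hw 1) 2 1, partialD_comm (hw 2) 0 2, partialD_comm (hw 2) 1 2]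
  ring

theorem sum_mul_advection (hu : ∀ i, ContDiff ℝ ∞ (u i)) (hv : ∀ i, ContDiff ℝ ∞ (v i))
    (hdiv : ∑ j, partialD j (u j) x = 0) :
    ∑ i, v i x * ∑ j, u j x * partialD j (v i) x
      = 1 / 2 * ∑ i, ∑ j, partialD j (fun y => u j y * (v i y * v i y)) x := by
  simp only [partialD_mul (hu _) ((hv _).mul (hv _)), partialD_mul (hv _) (hv _),
    Fin.sum_univ_three] at hdiv ⊢
  linear_combination (-1 / 2 * (v 0 x * v 0 x + v 1 x * v 1 x + v 2 x * v 2 x)) * hdiv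

theorem sum_mul_magnetic (hu : ∀ i, ContDiff ℝ ∞ (u i)) (hb : ∀ i, ContDiff ℝ ∞ (b i))
    (hdiv : ∑ j, partialD j (b j) x = 0) :
    ∑ i, u i x * (∑ j, b j x * partialD j (b i) x) + ∑ i, b i x * ∑ j, b j x * partialD j (u i) x
      = ∑ i, ∑ j, partialD j (fun y => b j y * (u i y * b i y)) x := by
  simp only [partialD_mul (hb _) ((hu _).mul (hb _)), partialD_mul (hu _) (hb _),
    Fin.sum_univ_three] at hdiv ⊢
  linear_combination (-(u 0 x * b 0 x + u 1 x * b 1 x + u 2 x * b 2 x)) * hdiv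

/-- The right-hand side is the divergence of the cross product of `w` and `u`. -/
theorem sum_mul_curl_sub (hu : ∀ i, ContDiff ℝ ∞ (u i)) (hw : ∀ i, ContDiff ℝ ∞ (w i)) :
    ∑ i, u i x * curl w i x - ∑ i, w i x * curl u i x
      = (partialD 0 (fun y => w 1 y * u 2 y) x - partialD 0 (fun y => w 2 y * u 1 y) x)
        + (partialD 1 (fun y => w 2 y * u 0 y) x - partialD 1 (fun y => w 0 y * u 2 y) x)
        + (partialD 2 (fun y => w 0 y * u 1 y) x - partialD 2 (fun y => w 1 y * u 0 y) x) := by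
  simp only [partialD_mul (hw _) (hu _), Fin.sum_univ_three, curl, Matrix.cons_val_zero,
    Matrix.cons_val_one, Matrix.cons_val]
  ring

/-- Together with `sum_curl_sq`, this makes `|curl u|²` and `|∇u|²` differ by a double divergence,
whence the term with coefficient `-1/2` in `∂ᵢ∂ⱼ(uᵢ uⱼ)` in `energyFlux`. -/
theorem sum_partialD_partialD_mul_of_solenoidal (hu : ∀ i, ContDiff ℝ ∞ (u i))
    (hdiv : ∀ y, ∑ j, partialD j (u j) y = 0) (x : E3) :
    ∑ i, ∑ j, partialD i (partialD j fun y => u i y * u j y) x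
      = ∑ i, ∑ j, partialD i (u j) x * partialD j (u i) x := by
  have h1 := sum_mul_gradient_divergence (x := x) hu
  have h2 : (fun y => ∑ j, partialD j (u j) y) = fun _ => 0 := funext hdiv
  simp only [h2, hdiv x] at h1
  have h3 : ∀ i : Fin 3, partialD i (fun _ => (0 : ℝ)) x = 0 := fun i => by simp [partialD]
  simp only [h3, mul_zero, Finset.sum_const_zero] at h1
  linarith

theorem sum_curl_sq :
    ∑ i, curl u i x ^ 2
      = (∑ i, ∑ j, partialD j (u i) x ^ 2) - ∑ i, ∑ j, partialD i (u j) x * partialD j (u i) x := by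
  simp only [Fin.sum_univ_three, curl, Matrix.cons_val_zero, Matrix.cons_val_one, Matrix.cons_val]
  ring

/-- This is the nonnegativity of the squared symmetric gradient. It limits the loss from the
grad-div term to half of `|∇w|²`. -/
theorem neg_sum_mul_transpose_le :
    -∑ i, ∑ j, partialD i (w j) x * partialD j (w i) x ≤ ∑ i, ∑ j, partialD j (w i) x ^ 2 := by
  have h : 0 ≤ ∑ i, ∑ j, (partialD i (w j) x + partialD j (w i) x) ^ 2 :=
    Finset.sum_nonneg fun i _ => Finset.sum_nonneg fun j _ => sq_nonneg _
  simp only [Fin.sum_univ_three] at h ⊢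
  linarith

/-- The sum of all transport and diffusion fluxes in the energy balance. -/
noncomputable def energyFlux (u b w : Fin 3 → E3 → ℝ) (x : E3) : ℝ :=
  1 / 2 * (∑ i, ∑ j, partialD j (partialD j fun y => u i y * u i y) x)
    + 1 / 2 * (∑ i, ∑ j, partialD j (partialD j fun y => b i y * b i y) x)
    + 1 / 2 * (∑ i, ∑ j, partialD j (partialD j fun y => w i y * w i y) x)
    + 1 / 2 * (∑ i, ∑ j, partialD i (partialD j fun y => w i y * w j y) x)
    + -1 / 2 * (∑ i, ∑ j, partialD i (partialD j fun y => u i y * u j y) x)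
    + -1 / 2 * (∑ i, ∑ j, partialD j (fun y => u j y * (u i y * u i y)) x)
    + -1 / 2 * (∑ i, ∑ j, partialD j (fun y => u j y * (b i y * b i y)) x)
    + -1 / 2 * (∑ i, ∑ j, partialD j (fun y => u j y * (w i y * w i y)) x)
    + (∑ i, ∑ j, partialD j (fun y => b j y * (u i y * b i y)) x)
    + ((partialD 0 (fun y => w 1 y * u 2 y) x - partialD 0 (fun y => w 2 y * u 1 y) x)
      + (partialD 1 (fun y => w 2 y * u 0 y) x - partialD 1 (fun y => w 0 y * u 2 y) x)
      + (partialD 2 (fun y => w 0 y * u 1 y) x - partialD 2 (fun y => w 1 y * u 0 y) x))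

/-- The local energy inequality. -/
theorem energy_inequality {P : E3 → ℝ} (hu : ∀ i, ContDiff ℝ ∞ (u i))
    (hb : ∀ i, ContDiff ℝ ∞ (b i)) (hw : ∀ i, ContDiff ℝ ∞ (w i))
    (hdivu : ∀ y, ∑ j, partialD j (u j) y = 0) (hdivb : ∀ y, ∑ j, partialD j (b j) y = 0)
    (hmom : ∀ i, -∑ j, partialD j (partialD j (u i)) x + ∑ j, u j x * partialD j (u i) x
      + partialD i P x = curl w i x + ∑ j, b j x * partialD j (b i) x)
    (hang : ∀ i, -∑ j, partialD j (partialD j (w i)) x + ∑ j, u j x * partialD j (w i) x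
      = partialD i (fun y => ∑ j, partialD j (w j) y) x + curl u i x - 2 * w i x)
    (hmag : ∀ i, -∑ j, partialD j (partialD j (b i)) x + ∑ j, u j x * partialD j (b i) x
      = ∑ j, b j x * partialD j (u i) x) :
    1 / 2 * ∑ i, ∑ j, (partialD j (u i) x ^ 2 + partialD j (b i) x ^ 2 + partialD j (w i) x ^ 2)
      ≤ energyFlux u b w x - ∑ i, u i x * partialD i P x := by
  have hm : ∑ i, u i x * partialD i P x = ∑ i, u i x * (∑ j, partialD j (partialD j (u i)) x)
      - ∑ i, u i x * (∑ j, u j x * partialD j (u i) x)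
      + ∑ i, u i x * curl w i x + ∑ i, u i x * ∑ j, b j x * partialD j (b i) x := by
    rw [← Finset.sum_sub_distrib, ← Finset.sum_add_distrib, ← Finset.sum_add_distrib]
    exact Finset.sum_congr rfl fun i _ => by linear_combination u i x * hmom i
  have ha : ∑ i, w i x * (∑ j, partialD j (partialD j (w i)) x)
      - ∑ i, w i x * (∑ j, u j x * partialD j (w i) x)
      + ∑ i, w i x * partialD i (fun y => ∑ j, partialD j (w j) y) x
      + ∑ i, w i x * curl u i x = 2 * ∑ i, w i x ^ 2 := by
    rw [← Finset.sum_sub_distrib, ← Finset.sum_add_distrib, ← Finset.sum_add_distrib,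
      Finset.mul_sum]
    exact Finset.sum_congr rfl fun i _ => by linear_combination -w i x * hang i
  have hg : ∑ i, b i x * (∑ j, partialD j (partialD j (b i)) x)
      - ∑ i, b i x * (∑ j, u j x * partialD j (b i) x)
      + ∑ i, b i x * (∑ j, b j x * partialD j (u i) x) = 0 := by
    rw [← Finset.sum_sub_distrib, ← Finset.sum_add_distrib]
    exact Finset.sum_eq_zero fun i _ => by linear_combination -b i x * hmag i
  -- The weights match the damping `2 |w|²` exactly and leave `|curl u|² / 2`, so half of `|∇u|²`
  -- survives.
  have hyoung : 2 * ∑ i, w i x * curl u i x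
      ≤ 2 * (∑ i, w i x ^ 2) + 1 / 2 * ∑ i, curl u i x ^ 2 := by
    rw [Finset.mul_sum, Finset.mul_sum, Finset.mul_sum, ← Finset.sum_add_distrib]
    exact Finset.sum_le_sum fun i _ => by nlinarith [sq_nonneg (2 * w i x - curl u i x)]
  have h1 := sum_mul_laplacian (x := x) hu
  have h2 := sum_mul_laplacian (x := x) hb
  have h3 := sum_mul_laplacian (x := x) hw
  have h4 := sum_mul_gradient_divergence (x := x) hw
  have h5 := sum_mul_advection hu hu (hdivu x)
  have h6 := sum_mul_advection hu hb (hdivu x)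
  have h7 := sum_mul_advection hu hw (hdivu x)
  have h8 := sum_mul_magnetic hu hb (hdivb x)
  have h9 := sum_mul_curl_sub (x := x) hu hw
  have h10 := sum_partialD_partialD_mul_of_solenoidal hu hdivu x
  have h11 := sum_curl_sq (u := u) (x := x)
  have h12 := neg_sum_mul_transpose_le (w := w) (x := x)
  have h13 : 0 ≤ ∑ i, ∑ j, partialD j (b i) x ^ 2 :=
    Finset.sum_nonneg fun i _ => Finset.sum_nonneg fun j _ => sq_nonneg _
  have h14 := sq_nonneg (∑ i, partialD i (w i) x)
  simp only [Finset.sum_add_distrib]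
  unfold energyFlux
  linarith

end energy

/-! ### Growth on balls and negligible fluxes -/

/-- The integrals of `ρ` over balls of radius `R` are `o(R)`. -/
def SublinearGrowth (ρ : E3 → ℝ) : Prop :=
  Tendsto (fun n : ℕ => ((n : ℝ) + 1)⁻¹ * ∫ x in Metric.closedBall 0 (2 * ((n : ℝ) + 1)), ρ x)
    atTop (𝓝 0)

/-- The integrals of the continuous function `h` against the cutoffs tend to zero. -/
def Negligible (h : E3 → ℝ) : Prop :=
  Continuous h ∧ Tendsto (fun n : ℕ => ∫ x, cutoff n x * h x) atTop (𝓝 0)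

section growth

variable {f g h ρ r ψ : E3 → ℝ}

theorem integrableOn_closedBall (hf : Continuous f) (R : ℝ) :
    IntegrableOn f (Metric.closedBall 0 R) :=
  hf.continuousOn.integrableOn_compact (isCompact_closedBall _ _)

theorem SublinearGrowth.add (hf : SublinearGrowth f) (hg : SublinearGrowth g)
    (hfc : Continuous f) (hgc : Continuous g) : SublinearGrowth fun x => f x + g x := by
  have h := Tendsto.add hf hg
  rw [add_zero] at h
  refine h.congr fun n => ?_
  rw [integral_add (integrableOn_closedBall hfc _) (integrableOn_closedBall hgc _)]
  ring

theorem SublinearGrowth.sum {F : Fin 3 → E3 → ℝ} (hF : ∀ i, SublinearGrowth (F i))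
    (hc : ∀ i, Continuous (F i)) : SublinearGrowth fun x => ∑ i, F i x := by
  simp only [Fin.sum_univ_three]
  exact ((hF 0).add (hF 1) (hc 0) (hc 1)).add (hF 2) ((hc 0).add (hc 1)) (hc 2)

/-- A pointwise substitute for Hölder's inequality on a ball of radius comparable to `N`. At the
threshold `|q| = N⁻²` the missing factor `|q| ^ (1/4)` equals `N ^ (-1/2)`; below it `q²` is at most
`N⁻⁴`, which beats the volume `N³`. -/
theorem sq_le_sqrt_mul_rpow_add (q : ℝ) {N : ℝ} (hN : 1 ≤ N) :
    q ^ 2 ≤ √N * |q| ^ (9 / 4 : ℝ) + (N ^ 4)⁻¹ := by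
  have hN0 : 0 < N := by linarith
  rcases le_or_gt |q| (N ^ 2)⁻¹ with h | h
  · have h1 : q ^ 2 ≤ (N ^ 4)⁻¹ := by
      rw [← sq_abs, show (N ^ 4)⁻¹ = ((N ^ 2)⁻¹) ^ 2 by rw [inv_pow, ← pow_mul]]
      exact pow_le_pow_left₀ (abs_nonneg q) h 2
    have h2 : 0 ≤ √N * |q| ^ (9 / 4 : ℝ) := by positivity
    linarith
  · have hq : 0 < |q| := lt_trans (by positivity) h
    have h1 : |q| ^ (9 / 4 : ℝ) = |q| ^ 2 * |q| ^ (1 / 4 : ℝ) := by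
      rw [← Real.rpow_natCast |q| 2, ← Real.rpow_add hq]
      norm_num
    have h2 : 1 ≤ √N * |q| ^ (1 / 4 : ℝ) := by
      have h3 : ((N ^ 2)⁻¹) ^ (1 / 4 : ℝ) ≤ |q| ^ (1 / 4 : ℝ) :=
        Real.rpow_le_rpow (by positivity) h.le (by norm_num)
      have h4 : √N * ((N ^ 2)⁻¹) ^ (1 / 4 : ℝ) = 1 := by
        rw [Real.inv_rpow (by positivity), ← Real.rpow_natCast N 2, ← Real.rpow_mul hN0.le,
          Real.sqrt_eq_rpow]
        norm_num
        exact mul_inv_cancel₀ (by positivity)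
      exact h4.symm.le.trans (mul_le_mul_of_nonneg_left h3 (Real.sqrt_nonneg _))
    have h5 : q ^ 2 ≤ √N * |q| ^ (9 / 4 : ℝ) := by
      rw [h1, ← sq_abs q]
      nlinarith [sq_nonneg |q|]
    have h6 : 0 < (N ^ 4)⁻¹ := by positivity
    linarith

theorem sublinearGrowth_sq (hf : Continuous f)
    (hint : Integrable fun x => |f x| ^ (9 / 4 : ℝ)) : SublinearGrowth fun x => f x ^ 2 := by
  set A := ∫ x, |f x| ^ (9 / 4 : ℝ)
  set V := (volume (Metric.ball (0 : E3) 1)).toReal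
  have hvol : ∀ R : ℝ, 0 ≤ R → (volume (Metric.closedBall (0 : E3) R)).toReal = R ^ 3 * V := by
    intro R hR
    rw [Measure.addHaar_closedBall _ _ hR, ENNReal.toReal_mul,
      ENNReal.toReal_ofReal (by positivity), finrank_euclideanSpace_fin]
  have hbound : ∀ n : ℕ, ((n : ℝ) + 1)⁻¹ * ∫ x in Metric.closedBall 0 (2 * ((n : ℝ) + 1)), f x ^ 2
      ≤ (√((n : ℝ) + 1))⁻¹ * (A + 8 * V) := by
    intro n
    set N : ℝ := (n : ℝ) + 1
    have hN : 1 ≤ N := by simp [N]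
    have hN0 : 0 < N := by linarith
    have hs1 : 1 ≤ √N := Real.one_le_sqrt.2 hN
    have hss : √N * √N = N := Real.mul_self_sqrt hN0.le
    have hconst : IntegrableOn (fun _ : E3 => (N ^ 4)⁻¹) (Metric.closedBall 0 (2 * N)) :=
      integrableOn_closedBall continuous_const _
    have h1 : ∫ x in Metric.closedBall 0 (2 * N), f x ^ 2 ≤ √N * A + (N ^ 4)⁻¹ * ((2 * N) ^ 3 * V) :=
      calc ∫ x in Metric.closedBall 0 (2 * N), f x ^ 2
          ≤ ∫ x in Metric.closedBall 0 (2 * N), (√N * |f x| ^ (9 / 4 : ℝ) + (N ^ 4)⁻¹) :=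
            integral_mono (integrableOn_closedBall (f := fun x => f x ^ 2) (hf.pow 2) _)
              ((hint.integrableOn.const_mul _).add hconst)
              fun x => sq_le_sqrt_mul_rpow_add _ hN
        _ = √N * (∫ x in Metric.closedBall 0 (2 * N), |f x| ^ (9 / 4 : ℝ))
            + (N ^ 4)⁻¹ * ((2 * N) ^ 3 * V) := by
            rw [integral_add (hint.integrableOn.const_mul _) hconst, integral_const_mul,
              setIntegral_const, Measure.real, hvol _ (by positivity), smul_eq_mul]
            ring
        _ ≤ _ := by
            gcongr
            exact setIntegral_le_integral hint (.of_forall fun x => by positivity)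
    have hV : 0 ≤ V := ENNReal.toReal_nonneg
    calc N⁻¹ * ∫ x in Metric.closedBall 0 (2 * N), f x ^ 2
        ≤ N⁻¹ * (√N * A + (N ^ 4)⁻¹ * ((2 * N) ^ 3 * V)) := by gcongr
      _ = (√N)⁻¹ * A + (N ^ 2)⁻¹ * (8 * V) := by
          have : N⁻¹ * √N = (√N)⁻¹ := by
            rw [inv_mul_eq_div, Real.sqrt_div_self]
          rw [mul_add, ← mul_assoc, this]
          congr 1
          field_simp
          ring
      _ ≤ (√N)⁻¹ * A + (√N)⁻¹ * (8 * V) := by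
          gcongr
          nlinarith
      _ = _ := by ring
  refine squeeze_zero (fun n => ?_) hbound ?_
  · exact mul_nonneg (by positivity) (integral_nonneg fun x => sq_nonneg _)
  · have h1 : Tendsto (fun n : ℕ => √((n : ℝ) + 1)) atTop atTop :=
      Real.tendsto_sqrt_atTop.comp (tendsto_atTop_add_const_right _ _ tendsto_natCast_atTop_atTop)
    simpa using h1.inv_tendsto_atTop.mul_const (A + 8 * V)

theorem Negligible.add (hf : Negligible f) (hg : Negligible g) :
    Negligible fun x => f x + g x := by
  refine ⟨hf.1.add hg.1, ?_⟩
  have h := hf.2.add hg.2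
  rw [add_zero] at h
  refine h.congr fun n => ?_
  have hi : ∀ {k : E3 → ℝ}, Continuous k → Integrable fun x => cutoff n x * k x := fun hk =>
    ((contDiff_cutoff n).continuous.mul hk).integrable_of_hasCompactSupport
      (hasCompactSupport_cutoff n).mul_right
  rw [← integral_add (hi hf.1) (hi hg.1)]
  simp_rw [mul_add]

theorem Negligible.const_mul (c : ℝ) (hf : Negligible f) : Negligible fun x => c * f x := by
  refine ⟨hf.1.const_mul c, ?_⟩
  have h := hf.2.const_mul c
  rw [mul_zero] at h
  refine h.congr fun n => ?_
  rw [← integral_const_mul]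
  congr 1 with x
  ring

theorem Negligible.sub (hf : Negligible f) (hg : Negligible g) :
    Negligible fun x => f x - g x := by
  simpa [sub_eq_add_neg] using hf.add (hg.const_mul (-1))

theorem Negligible.sum {F : Fin 3 → E3 → ℝ} (hF : ∀ i, Negligible (F i)) :
    Negligible fun x => ∑ i, F i x := by
  simp only [Fin.sum_univ_three]
  exact ((hF 0).add (hF 1)).add (hF 2)

theorem norm_stdVec (j : Fin 3) : ‖stdVec j‖ = 1 := by simp [stdVec]

theorem exists_abs_partialD_cutoff_le :
    ∃ C, 0 ≤ C ∧ ∀ (n : ℕ) (j : Fin 3) (x : E3),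
      |partialD j (cutoff n) x| ≤ C * ((n : ℝ) + 1)⁻¹ := by
  obtain ⟨C, hC0, hC⟩ := exists_norm_iteratedFDeriv_cutoff_le 1
  refine ⟨C, hC0, fun n j x => ?_⟩
  have h := hC n x
  rw [norm_iteratedFDeriv_one, pow_one] at h
  refine le_trans ?_ h
  have h1 := (fderiv ℝ (cutoff n) x).le_opNorm (stdVec j)
  rw [norm_stdVec, mul_one] at h1
  exact h1

theorem partialD_partialD_eq_iteratedFDeriv (hf : ContDiff ℝ ∞ f) (i j : Fin 3) (x : E3) :
    partialD i (partialD j f) x = iteratedFDeriv ℝ 2 f x ![stdVec i, stdVec j] := by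
  have h : DifferentiableAt ℝ (fderiv ℝ f) x :=
    (hf.fderiv_right (m := ∞) (by simp)).differentiable (by simp) x
  unfold partialD
  rw [fderiv_clm_apply h (differentiableAt_const _), iteratedFDeriv_two_apply]
  simp

/-- Scaling gives the rate `(n + 1)⁻²`. Only the weaker rate is kept, so that first- and
second-order fluxes are treated alike. -/
theorem exists_abs_partialD_partialD_cutoff_le :
    ∃ C, 0 ≤ C ∧ ∀ (n : ℕ) (i j : Fin 3) (x : E3),
      |partialD i (partialD j (cutoff n)) x| ≤ C * ((n : ℝ) + 1)⁻¹ := by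
  obtain ⟨C, hC0, hC⟩ := exists_norm_iteratedFDeriv_cutoff_le 2
  refine ⟨C, hC0, fun n i j x => ?_⟩
  rw [partialD_partialD_eq_iteratedFDeriv (contDiff_cutoff n)]
  have h := (iteratedFDeriv ℝ 2 (cutoff n) x).le_opNorm ![stdVec i, stdVec j]
  simp only [Fin.prod_univ_two, Matrix.cons_val_zero, Matrix.cons_val_one, norm_stdVec,
    mul_one] at h
  refine h.trans ((hC n x).trans (mul_le_mul_of_nonneg_left ?_ hC0))
  refine pow_le_of_le_one (by positivity) (inv_le_one_of_one_le₀ ?_) two_ne_zero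
  linarith [n.cast_nonneg (α := ℝ)]

theorem tsupport_partialD_subset (f : E3 → ℝ) (j : Fin 3) : tsupport (partialD j f) ⊆ tsupport f :=
  tsupport_fderiv_apply_subset ℝ (stdVec j)

theorem abs_integral_mul_le {c K R : ℝ} (hr : Continuous r) (hρ : Continuous ρ)
    (hψ : Continuous ψ) (hK : ∀ x, |r x| ≤ K * ρ x) (hc : ∀ x, |ψ x| ≤ c)
    (hsupp : tsupport ψ ⊆ Metric.closedBall 0 R) :
    |∫ x, r x * ψ x| ≤ c * (K * ∫ x in Metric.closedBall 0 R, ρ x) := by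
  have h0 : ∀ x, x ∉ Metric.closedBall 0 R → r x * ψ x = 0 := fun x hx => by
    rw [image_eq_zero_of_notMem_tsupport fun h => hx (hsupp h), mul_zero]
  rw [← setIntegral_eq_integral_of_forall_compl_eq_zero h0, ← integral_const_mul,
    ← integral_const_mul]
  refine abs_integral_le_integral_abs.trans (integral_mono
    (integrableOn_closedBall (hr.mul hψ) R).abs
    (integrableOn_closedBall (continuous_const.mul (continuous_const.mul hρ)) R) fun x => ?_)
  change |r x * ψ x| ≤ c * (K * ρ x)
  rw [abs_mul, mul_comm]
  exact mul_le_mul (hc x) (hK x) (abs_nonneg _) ((abs_nonneg _).trans (hc x))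

/-- The weight `Ψ n` is `O(1/R)` and lives on a ball where the integral of `ρ` is `o(R)`. It is
applied to derivatives of the cutoffs. -/
theorem tendsto_integral_mul_zero (hgrow : SublinearGrowth ρ) {K C : ℝ} {Ψ : ℕ → E3 → ℝ}
    (hr : Continuous r) (hρ : Continuous ρ) (hK : ∀ x, |r x| ≤ K * ρ x)
    (hΨ : ∀ n, Continuous (Ψ n)) (hC : ∀ n x, |Ψ n x| ≤ C * ((n : ℝ) + 1)⁻¹)
    (hsupp : ∀ n : ℕ, tsupport (Ψ n) ⊆ Metric.closedBall 0 (2 * ((n : ℝ) + 1))) :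
    Tendsto (fun n => ∫ x, r x * Ψ n x) atTop (𝓝 0) := by
  have h := Tendsto.const_mul (C * K) hgrow
  rw [mul_zero] at h
  refine squeeze_zero_norm (fun n => ?_) h
  rw [Real.norm_eq_abs]
  refine (abs_integral_mul_le hr hρ (hΨ n) hK (hC n) (hsupp n)).trans_eq ?_
  ring

theorem negligible_partialD (hgrow : SublinearGrowth ρ) (hρ : Continuous ρ) {K : ℝ}
    (hr : ContDiff ℝ ∞ r) (hK : ∀ x, |r x| ≤ K * ρ x) (j : Fin 3) :
    Negligible (partialD j r) := by
  refine ⟨(hr.partialD j).continuous, ?_⟩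
  obtain ⟨C, -, hC⟩ := exists_abs_partialD_cutoff_le
  have h := (tendsto_integral_mul_zero hgrow hr.continuous hρ hK
    (fun n => ((contDiff_cutoff n).partialD j).continuous) (fun n => hC n j)
    (fun n => (tsupport_partialD_subset _ j).trans (tsupport_cutoff_subset n))).neg
  rw [neg_zero] at h
  refine h.congr fun n => ?_
  rw [integral_mul_partialD hr (contDiff_cutoff n) (hasCompactSupport_cutoff n), neg_neg]
  simp_rw [mul_comm]

theorem negligible_partialD_partialD (hgrow : SublinearGrowth ρ) (hρ : Continuous ρ) {K : ℝ}
    (hr : ContDiff ℝ ∞ r) (hK : ∀ x, |r x| ≤ K * ρ x) (i j : Fin 3) :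
    Negligible (partialD i (partialD j r)) := by
  refine ⟨((hr.partialD j).partialD i).continuous, ?_⟩
  obtain ⟨C, -, hC⟩ := exists_abs_partialD_partialD_cutoff_le
  have h := tendsto_integral_mul_zero hgrow hr.continuous hρ hK
    (fun n => (((contDiff_cutoff n).partialD i).partialD j).continuous) (fun n => hC n j i)
    (fun n => (tsupport_partialD_subset _ j).trans
      ((tsupport_partialD_subset _ i).trans (tsupport_cutoff_subset n)))
  refine h.congr fun n => ?_
  rw [integral_mul_partialD_partialD hr (contDiff_cutoff n) (hasCompactSupport_cutoff n)]
  simp_rw [mul_comm]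

/-- For `n` large, `cutoff n` is `1` on the support of `cutoff m`. Hence `∫ cutoff m * f ≤ ∫ cutoff
n * h`, and the right-hand side tends to zero with `m` fixed. -/
theorem eq_zero_of_le_negligible (hf : Continuous f) (hf0 : ∀ x, 0 ≤ f x) (hh : Negligible h)
    (hle : ∀ x, f x ≤ h x) (x : E3) : f x = 0 := by
  have hi : ∀ (n : ℕ) {k : E3 → ℝ}, Continuous k → Integrable fun x => cutoff n x * k x :=
    fun n _ hk => ((contDiff_cutoff n).continuous.mul hk).integrable_of_hasCompactSupport
      (hasCompactSupport_cutoff n).mul_right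
  obtain ⟨m, hm⟩ := exists_nat_ge ‖x‖
  have hzero : ∫ y, cutoff m y * f y = 0 := by
    refine le_antisymm (ge_of_tendsto hh.2 ?_)
      (integral_nonneg fun y => mul_nonneg (cutoff_nonneg m) (hf0 y))
    filter_upwards [eventually_ge_atTop (2 * (m + 1))] with n hn
    refine integral_mono (hi m hf) (hi n hh.1) fun y => ?_
    refine mul_le_mul ?_ (hle y) (hf0 y) (cutoff_nonneg n)
    by_cases hy : y ∈ Metric.closedBall (0 : E3) (2 * ((m : ℝ) + 1))
    · rw [cutoff_eq_one n]
      · exact cutoff_le_one m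
      · rw [mem_closedBall_zero_iff] at hy
        have : ((2 * (m + 1) : ℕ) : ℝ) ≤ n := by exact_mod_cast hn
        push_cast at this
        linarith
    · rw [Function.notMem_support.1 fun hs => hy (support_cutoff_subset m hs)]
      exact cutoff_nonneg n
  have hcont : Continuous fun y => cutoff m y * f y := (contDiff_cutoff m).continuous.mul hf
  have h0 := (integral_eq_zero_iff_of_nonneg
    (fun y => mul_nonneg (cutoff_nonneg m) (hf0 y)) (hi m hf)).1 hzero
  have h1 : cutoff m x * f x = 0 :=
    congrFun ((hcont.ae_eq_iff_eq volume continuous_const).1 h0) x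
  rwa [cutoff_eq_one m (hm.trans (by linarith : (m : ℝ) ≤ m + 1)), one_mul] at h1

end growth

/-! ### The pressure term in the energy balance -/

section weakFormulation

variable {u b w : Fin 3 → E3 →ᵇ ℝ} {P : E3 → ℝ}

theorem integralAgainst_lineDerivOp {c : E3 →ᵇ ℝ} (hc : ContDiff ℝ ∞ c) {S : 𝓢(E3, ℝ)}
    (hS : HasCompactSupport S) (j : Fin 3) :
    integralAgainst c (∂_{stdVec j} S) = -∫ x, partialD j c x * S x :=
  integral_mul_partialD hc (S.smooth ⊤) hS j

theorem integralAgainst_lineDerivOp_lineDerivOp {c : E3 →ᵇ ℝ} (hc : ContDiff ℝ ∞ c)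
    {S : 𝓢(E3, ℝ)} (hS : HasCompactSupport S) (i j : Fin 3) :
    integralAgainst c (∂_{stdVec i} (∂_{stdVec j} S))
      = ∫ x, partialD j (partialD i c) x * S x :=
  integral_mul_partialD_partialD hc (S.smooth ⊤) hS i j

theorem integrable_mul_compactSupport {h : E3 → ℝ} (hh : Continuous h) {S : 𝓢(E3, ℝ)}
    (hS : HasCompactSupport S) : Integrable fun x => h x * S x :=
  (hh.mul S.continuous).integrable_of_hasCompactSupport hS.mul_left

/-- The quadratic term `u ⊗ u - b ⊗ b`. -/
noncomputable def stress (u b : Fin 3 → E3 →ᵇ ℝ) (i j : Fin 3) : E3 →ᵇ ℝ :=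
  u i * u j - b i * b j

theorem coe_stress (i j : Fin 3) :
    ⇑(stress u b i j) = fun x => u i x * u j x - b i x * b j x := rfl

theorem contDiff_stress (hu : ∀ i, ContDiff ℝ ∞ (u i)) (hb : ∀ i, ContDiff ℝ ∞ (b i))
    (i j : Fin 3) : ContDiff ℝ ∞ (stress u b i j) :=
  ((hu i).mul (hu j)).sub ((hb i).mul (hb j))

/-- Solenoidality puts the quadratic terms in divergence form, so that the weak form involves no
derivatives of the fields. -/
theorem sum_partialD_stress (hu : ∀ i, ContDiff ℝ ∞ (u i)) (hb : ∀ i, ContDiff ℝ ∞ (b i))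
    {x : E3} (hdivu : ∑ j, partialD j (u j) x = 0) (hdivb : ∑ j, partialD j (b j) x = 0)
    (i : Fin 3) :
    ∑ j, partialD j (stress u b i j) x
      = ∑ j, u j x * partialD j (u i) x - ∑ j, b j x * partialD j (b i) x := by
  simp only [coe_stress, partialD_sub ((hu _).mul (hu _)) ((hb _).mul (hb _)),
    partialD_mul (hu _) (hu _), partialD_mul (hb _) (hb _), Fin.sum_univ_three] at hdivu hdivb ⊢
  linear_combination u i x * hdivu - b i x * hdivb

/-- The weak form of the momentum equation is the pairing of the test field with `∇P`. -/
theorem weakForm_eq (hu : ∀ i, ContDiff ℝ ∞ (u i)) (hb : ∀ i, ContDiff ℝ ∞ (b i))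
    (hw : ∀ i, ContDiff ℝ ∞ (w i))
    (hdivu : ∀ y, ∑ j, partialD j (u j) y = 0) (hdivb : ∀ y, ∑ j, partialD j (b j) y = 0)
    (hmom : ∀ x i, -∑ j, partialD j (partialD j (u i)) x + ∑ j, u j x * partialD j (u i) x
      + partialD i P x = curl (fun i => w i) i x + ∑ j, b j x * partialD j (b i) x)
    {V : Fin 3 → 𝓢(E3, ℝ)} (hV : ∀ i, HasCompactSupport (V i)) :
    weakForm u w (stress u b) V = ∑ i, ∫ x, partialD i P x * V i x := by
  have hc2 : ∀ i j, Continuous (partialD j (partialD j (u i))) := fun i j =>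
    (((hu i).partialD j).partialD j).continuous
  have hcs : ∀ i j, Continuous (partialD j (stress u b i j)) := fun i j =>
    ((contDiff_stress hu hb i j).partialD j).continuous
  have hcw : ∀ i j, Continuous (partialD j (w i)) := fun i j => ((hw i).partialD j).continuous
  have hcc : ∀ i, Continuous (curl (fun i => w i) i) := fun i => by
    fin_cases i
    · exact (hcw 2 1).sub (hcw 1 2)
    · exact (hcw 0 2).sub (hcw 2 0)
    · exact (hcw 1 0).sub (hcw 0 1)
  have hP : ∀ i, ∫ x, partialD i P x * V i x
      = ∑ j, ((∫ x, partialD j (partialD j (u i)) x * V i x)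
          - ∫ x, partialD j (stress u b i j) x * V i x)
        + ∫ x, curl (fun i => w i) i x * V i x := fun i => by
    have hpt : ∀ x, partialD i P x * V i x
        = ∑ j, (partialD j (partialD j (u i)) x * V i x - partialD j (stress u b i j) x * V i x)
          + curl (fun i => w i) i x * V i x := fun x => by
      rw [Finset.sum_sub_distrib, ← Finset.sum_mul, ← Finset.sum_mul,
        sum_partialD_stress hu hb (hdivu x) (hdivb x)]
      linear_combination V i x * hmom x i
    have hi : ∀ j, Integrable fun x => partialD j (partialD j (u i)) x * V i x
        - partialD j (stress u b i j) x * V i x := fun j =>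
      (integrable_mul_compactSupport (hc2 i j) (hV i)).sub
        (integrable_mul_compactSupport (hcs i j) (hV i))
    simp_rw [hpt]
    rw [integral_add (integrable_finsetSum _ fun j _ => hi j)
      (integrable_mul_compactSupport (hcc i) (hV i)), integral_finsetSum _ fun j _ => hi j]
    congr 1
    exact Finset.sum_congr rfl fun j _ => integral_sub
      (integrable_mul_compactSupport (hc2 i j) (hV i))
      (integrable_mul_compactSupport (hcs i j) (hV i))
  have hcurl : ∀ i j k l m, ∫ x, (partialD j (w k) x - partialD l (w m) x) * V i x
      = (∫ x, partialD j (w k) x * V i x) - ∫ x, partialD l (w m) x * V i x := fun i j k l m => by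
    simp_rw [sub_mul]
    exact integral_sub (integrable_mul_compactSupport (hcw k j) (hV i))
      (integrable_mul_compactSupport (hcw m l) (hV i))
  have hc0 : ∫ x, curl (fun i => w i) 0 x * V 0 x
      = (∫ x, partialD 1 (w 2) x * V 0 x) - ∫ x, partialD 2 (w 1) x * V 0 x := hcurl ..
  have hc1 : ∫ x, curl (fun i => w i) 1 x * V 1 x
      = (∫ x, partialD 2 (w 0) x * V 1 x) - ∫ x, partialD 0 (w 2) x * V 1 x := hcurl ..
  have hc3 : ∫ x, curl (fun i => w i) 2 x * V 2 x
      = (∫ x, partialD 0 (w 1) x * V 2 x) - ∫ x, partialD 1 (w 0) x * V 2 x := hcurl ..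
  simp only [weakForm, hP, integralAgainst_lineDerivOp_lineDerivOp (hu _) (hV _),
    integralAgainst_lineDerivOp (contDiff_stress hu hb _ _) (hV _),
    integralAgainst_lineDerivOp (hw _) (hV _), ← sub_eq_add_neg]
  rw [Finset.sum_add_distrib,
    Fin.sum_univ_three (f := fun i => ∫ x, curl (fun i => w i) i x * V i x), hc0, hc1, hc3]
  ring

/-- The pressure does not contribute to the global energy balance. -/
theorem negligible_pressure (hu : ∀ i, ContDiff ℝ ∞ (u i)) (hb : ∀ i, ContDiff ℝ ∞ (b i))
    (hw : ∀ i, ContDiff ℝ ∞ (w i)) (hPs : ContDiff ℝ ∞ P)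
    (hu4 : ∀ i, Integrable fun x => u i x ^ 4) (hb4 : ∀ i, Integrable fun x => b i x ^ 4)
    (hw4 : ∀ i, Integrable fun x => w i x ^ 4)
    (hgrow : ∀ i, SublinearGrowth fun x => u i x ^ 2)
    (hdivu : ∀ y, ∑ j, partialD j (u j) y = 0) (hdivb : ∀ y, ∑ j, partialD j (b j) y = 0)
    (hmom : ∀ x i, -∑ j, partialD j (partialD j (u i)) x + ∑ j, u j x * partialD j (u i) x
      + partialD i P x = curl (fun i => w i) i x + ∑ j, b j x * partialD j (b i) x) :
    Negligible fun x => ∑ i, u i x * partialD i P x := by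
  refine ⟨continuous_finsetSum _ fun i _ => (u i).continuous.mul (hPs.partialD i).continuous, ?_⟩
  have hdiv : ∀ S : 𝓢(E3, ℝ), HasCompactSupport S →
      ∑ i, integralAgainst (u i) (∂_{stdVec i} S) = 0 := fun S hS => by
    simp_rw [integralAgainst_lineDerivOp (hu _) hS]
    rw [Finset.sum_neg_distrib, ← integral_finsetSum _ fun i _ =>
      integrable_mul_compactSupport ((hu i).partialD i).continuous hS]
    simp_rw [← Finset.sum_mul, hdivu, zero_mul, integral_zero, neg_zero]
  have hweak : ∀ V : Fin 3 → 𝓢(E3, ℝ), (∀ i, HasCompactSupport (V i)) →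
      ∑ i, ∂_{stdVec i} (V i) = 0 → weakForm u w (stress u b) V = 0 := fun V hV hV0 => by
    rw [weakForm_eq hu hb hw hdivu hdivb hmom hV]
    have h1 : ∀ i, ∫ x, partialD i P x * V i x
        = -∫ x, P x * (∂_{stdVec i} (V i) : 𝓢(E3, ℝ)) x := fun i => by
      have := integral_mul_partialD hPs ((V i).smooth ⊤) (hV i) i
      rw [eq_comm, neg_eq_iff_eq_neg]
      exact this
    simp_rw [h1]
    rw [Finset.sum_neg_distrib, ← integral_finsetSum _ fun i _ =>
      integrable_mul_compactSupport hPs.continuous (hasCompactSupport_lineDerivOp (hV i) i)]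
    simp_rw [← Finset.mul_sum, ← sum_apply, hV0, zero_apply, mul_zero, integral_zero, neg_zero]
  have hs2 : ∀ i j, Integrable fun x => stress u b i j x ^ 2 := fun i j => by
    refine ((((hu4 i).add (hu4 j)).add (hb4 i)).add (hb4 j)).mono'
      ((stress u b i j).continuous.pow 2).aestronglyMeasurable (.of_forall fun x => ?_)
    rw [Real.norm_of_nonneg (sq_nonneg _)]
    change (u i x * u j x - b i x * b j x) ^ 2 ≤ u i x ^ 4 + u j x ^ 4 + b i x ^ 4 + b j x ^ 4
    nlinarith [sq_nonneg (u i x * u j x + b i x * b j x), sq_nonneg (u i x ^ 2 - u j x ^ 2),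
      sq_nonneg (b i x ^ 2 - b j x ^ 2)]
  -- The stress is bounded and lies in `L²`, hence in `L⁴`.
  have hs4 : ∀ i j, Integrable fun x => stress u b i j x ^ 4 := fun i j => by
    have h := (hs2 i j).bdd_mul (stress u b i j ^ 2).continuous.aestronglyMeasurable
      (.of_forall (stress u b i j ^ 2).norm_coe_le_norm)
    refine h.congr (.of_forall fun x => ?_)
    change stress u b i j x ^ 2 * stress u b i j x ^ 2 = _
    ring
  obtain ⟨C, hC0, hC⟩ := exists_abs_partialD_cutoff_le
  set ρ : E3 → ℝ := fun x => ∑ i, u i x ^ 2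
  have hρc : Continuous ρ := continuous_finsetSum _ fun i _ => (u i).continuous.pow 2
  have hρg : SublinearGrowth ρ := .sum hgrow fun i => (u i).continuous.pow 2
  -- The test field `φ u`. Its divergence is `u · ∇φ`, since `u` is solenoidal.
  set F : ℕ → Fin 3 → 𝓢(E3, ℝ) := fun n i =>
    ((hasCompactSupport_cutoff n).mul_right (f' := u i)).toSchwartzMap
      ((contDiff_cutoff n).mul (hu i))
  have hFc : ∀ n i, HasCompactSupport (F n i) := fun n i =>
    (hasCompactSupport_cutoff n).mul_right
  have hFdiv : ∀ n x, (∑ i, ∂_{stdVec i} (F n i) : 𝓢(E3, ℝ)) x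
      = ∑ i, u i x * partialD i (cutoff n) x := fun n x => by
    have h1 : ∀ i, (∂_{stdVec i} (F n i) : 𝓢(E3, ℝ)) x
        = cutoff n x * partialD i (u i) x + u i x * partialD i (cutoff n) x := fun i =>
      partialD_mul (contDiff_cutoff n) (hu i)
    simp_rw [sum_apply, h1]
    rw [Finset.sum_add_distrib, ← Finset.mul_sum, hdivu, mul_zero, zero_add]
  set X : ℕ → ℝ := fun n => ∫ x, (∑ i, ∂_{stdVec i} (F n i) : 𝓢(E3, ℝ)) x ^ 2
  -- The square of `∇φ` is `O(R⁻²)`; one factor `R⁻¹` already suffices against the growth `o(R)`,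
  -- and the other is bounded by `1`.
  have hX : Tendsto X atTop (𝓝 0) := by
    have hlim := Tendsto.const_mul (3 * C ^ 2) hρg
    rw [mul_zero] at hlim
    refine squeeze_zero (fun n => integral_nonneg fun x => sq_nonneg _) (fun n => ?_) hlim
    have hN : ((n : ℝ) + 1)⁻¹ ≤ 1 :=
      inv_le_one_of_one_le₀ (by linarith [n.cast_nonneg (α := ℝ)])
    have hN0 : (0 : ℝ) ≤ ((n : ℝ) + 1)⁻¹ := by positivity
    have hout : ∀ x, x ∉ Metric.closedBall (0 : E3) (2 * ((n : ℝ) + 1)) →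
        (∑ i, u i x * partialD i (cutoff n) x) ^ 2 = 0 := fun x hx => by
      have h1 : ∀ i, partialD i (cutoff n) x = 0 := fun i => image_eq_zero_of_notMem_tsupport
        fun h => hx (tsupport_cutoff_subset n (tsupport_partialD_subset _ i h))
      simp [h1]
    have hpt : ∀ x, (∑ i, u i x * partialD i (cutoff n) x) ^ 2
        ≤ 3 * C ^ 2 * ((n : ℝ) + 1)⁻¹ * ρ x := fun x => by
      have h1 : (∑ i, u i x * partialD i (cutoff n) x) ^ 2
          ≤ 3 * ∑ i, (u i x * partialD i (cutoff n) x) ^ 2 := by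
        have := sq_sum_le_card_mul_sum_sq (s := Finset.univ)
          (f := fun i : Fin 3 => u i x * partialD i (cutoff n) x)
        simpa using this
      refine h1.trans ?_
      simp only [ρ, Finset.mul_sum]
      refine Finset.sum_le_sum fun i _ => ?_
      have h2 : partialD i (cutoff n) x ^ 2 ≤ C ^ 2 * ((n : ℝ) + 1)⁻¹ := by
        rw [← sq_abs]
        calc |partialD i (cutoff n) x| ^ 2 ≤ (C * ((n : ℝ) + 1)⁻¹) ^ 2 :=
              pow_le_pow_left₀ (abs_nonneg _) (hC n i x) 2
          _ = C ^ 2 * (((n : ℝ) + 1)⁻¹ * ((n : ℝ) + 1)⁻¹) := by ring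
          _ ≤ C ^ 2 * (((n : ℝ) + 1)⁻¹ * 1) := by gcongr
          _ = _ := by ring
      calc 3 * (u i x * partialD i (cutoff n) x) ^ 2
          = 3 * (u i x ^ 2 * partialD i (cutoff n) x ^ 2) := by ring
        _ ≤ 3 * (u i x ^ 2 * (C ^ 2 * ((n : ℝ) + 1)⁻¹)) := by gcongr
        _ = _ := by ring
    have hcont : Continuous fun x => (∑ i, u i x * partialD i (cutoff n) x) ^ 2 :=
      (continuous_finsetSum _ fun i _ =>
        (u i).continuous.mul ((contDiff_cutoff n).partialD i).continuous).pow 2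
    simp only [X, hFdiv]
    rw [← setIntegral_eq_integral_of_forall_compl_eq_zero hout, ← mul_assoc,
      ← integral_const_mul]
    exact integral_mono (integrableOn_closedBall hcont _)
      (integrableOn_closedBall (continuous_const.mul hρc) _) hpt
  set A := ∑ i, ∑ j, ∫ x, stress u b i j x ^ 2
  have hA0 : 0 ≤ A := Finset.sum_nonneg fun i _ => Finset.sum_nonneg fun j _ =>
    integral_nonneg fun x => sq_nonneg _
  have hkey : ∀ n t, 0 < t →
      |∫ x, cutoff n x * ∑ i, u i x * partialD i P x| ≤ t * A + 9 * t⁻¹ * X n := by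
    intro n t ht
    have h1 := abs_weakForm_le hu4 hw4 hs4 hs2 hdiv hweak (F n) ht
    rw [weakForm_eq hu hb hw hdivu hdivb hmom (hFc n), ← integral_finsetSum _ fun i _ =>
      integrable_mul_compactSupport (hPs.partialD i).continuous (hFc n i)] at h1
    refine le_of_eq_of_le ?_ h1
    congr 2 with x
    rw [Finset.mul_sum]
    refine Finset.sum_congr rfl fun i _ => ?_
    change _ = partialD i P x * (cutoff n x * u i x)
    ring
  rw [Metric.tendsto_nhds]
  intro ε hε
  -- `A` does not depend on `n`, so `t` is fixed first to make `t * A` small, and only then is `n`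
  -- taken large.
  set t := ε / (2 * (A + 1))
  have ht : 0 < t := by positivity
  have htA : t * A < ε / 2 := by
    have : t * (A + 1) = ε / 2 := by
      simp only [t]
      field_simp
    nlinarith
  have hlim := hX.const_mul (9 * t⁻¹)
  rw [mul_zero] at hlim
  filter_upwards [hlim.eventually_lt_const (half_pos hε)] with n hn
  rw [Real.dist_eq, sub_zero]
  linarith [hkey n t ht]

end weakFormulation

/-! ### Bounded fields and the Liouville conclusion -/

section liouville

/-- The energy flux of a bounded field whose squares grow sublinearly is negligible. -/
theorem negligible_energyFlux {u b w : Fin 3 → E3 →ᵇ ℝ} (hu : ∀ i, ContDiff ℝ ∞ (u i))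
    (hb : ∀ i, ContDiff ℝ ∞ (b i)) (hw : ∀ i, ContDiff ℝ ∞ (w i))
    (hgu : ∀ i, SublinearGrowth fun x => u i x ^ 2)
    (hgb : ∀ i, SublinearGrowth fun x => b i x ^ 2)
    (hgw : ∀ i, SublinearGrowth fun x => w i x ^ 2) :
    Negligible (energyFlux (fun i => u i) (fun i => b i) (fun i => w i)) := by
  have hc : ∀ z : E3 →ᵇ ℝ, Continuous fun x => z x ^ 2 := fun z => z.continuous.pow 2
  have hcs : ∀ z : Fin 3 → E3 →ᵇ ℝ, Continuous fun x => ∑ i, z i x ^ 2 := fun z =>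
    continuous_finsetSum _ fun i _ => hc (z i)
  set ρ : E3 → ℝ := fun x => (∑ i, u i x ^ 2) + (∑ i, b i x ^ 2) + ∑ i, w i x ^ 2 with hρdef
  have hρc : Continuous ρ := ((hcs u).add (hcs b)).add (hcs w)
  have hρ : SublinearGrowth ρ :=
    ((SublinearGrowth.sum hgu fun i => hc (u i)).add (.sum hgb fun i => hc (b i)) (hcs u)
      (hcs b)).add (.sum hgw fun i => hc (w i)) ((hcs u).add (hcs b)) (hcs w)
  have hle : ∀ (z : Fin 3 → E3 →ᵇ ℝ) i x, z i x ^ 2 ≤ ∑ i, z i x ^ 2 := fun z i x =>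
    Finset.single_le_sum (f := fun i => z i x ^ 2) (fun j _ => sq_nonneg _) (Finset.mem_univ i)
  have hnn : ∀ (z : Fin 3 → E3 →ᵇ ℝ) x, 0 ≤ ∑ i, z i x ^ 2 := fun z x =>
    Finset.sum_nonneg fun i _ => sq_nonneg _
  have hul : ∀ i x, u i x ^ 2 ≤ ρ x := fun i x => by
    linarith [hle u i x, hnn b x, hnn w x]
  have hbl : ∀ i x, b i x ^ 2 ≤ ρ x := fun i x => by
    linarith [hle b i x, hnn u x, hnn w x]
  have hwl : ∀ i x, w i x ^ 2 ≤ ρ x := fun i x => by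
    linarith [hle w i x, hnn u x, hnn b x]
  have hmul : ∀ {y z : E3 →ᵇ ℝ}, (∀ x, y x ^ 2 ≤ ρ x) → (∀ x, z x ^ 2 ≤ ρ x) →
      ∀ x, |y x * z x| ≤ 1 * ρ x := fun hy hz x => by
    rw [abs_le]
    constructor <;> nlinarith [hy x, hz x]
  -- In the cubic fluxes one factor is estimated by its sup norm, reducing them to the quadratic
  -- case.
  have hmul3 : ∀ {y z : E3 →ᵇ ℝ} (v : E3 →ᵇ ℝ), (∀ x, y x ^ 2 ≤ ρ x) → (∀ x, z x ^ 2 ≤ ρ x) →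
      ∀ x, |v x * (y x * z x)| ≤ ‖v‖ * ρ x := fun v hy hz x => by
    rw [abs_mul, ← one_mul (ρ x)]
    exact mul_le_mul (v.norm_coe_le_norm x) (hmul hy hz x) (abs_nonneg _) (norm_nonneg _)
  have h2 : ∀ {y z : E3 →ᵇ ℝ}, ContDiff ℝ ∞ y → ContDiff ℝ ∞ z → (∀ x, y x ^ 2 ≤ ρ x) →
      (∀ x, z x ^ 2 ≤ ρ x) → ∀ i j, Negligible (partialD i (partialD j fun x => y x * z x)) :=
    fun hy hz hyl hzl => negligible_partialD_partialD hρ hρc (hy.mul hz) (hmul hyl hzl)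
  have h1 : ∀ {y z : E3 →ᵇ ℝ}, ContDiff ℝ ∞ y → ContDiff ℝ ∞ z → (∀ x, y x ^ 2 ≤ ρ x) →
      (∀ x, z x ^ 2 ≤ ρ x) → ∀ j, Negligible (partialD j fun x => y x * z x) :=
    fun hy hz hyl hzl => negligible_partialD hρ hρc (hy.mul hz) (hmul hyl hzl)
  have h3 : ∀ {v y z : E3 →ᵇ ℝ}, ContDiff ℝ ∞ v → ContDiff ℝ ∞ y → ContDiff ℝ ∞ z →
      (∀ x, y x ^ 2 ≤ ρ x) → (∀ x, z x ^ 2 ≤ ρ x) → ∀ j,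
      Negligible (partialD j fun x => v x * (y x * z x)) := fun hv hy hz hyl hzl =>
    negligible_partialD hρ hρc (hv.mul (hy.mul hz)) (hmul3 _ hyl hzl)
  refine .add (.add (.add (.add (.add (.add (.add (.add (.add ?_ ?_) ?_) ?_) ?_) ?_) ?_) ?_) ?_)
    (.add (.add ?_ ?_) ?_)
  · exact .const_mul _ <| .sum fun i => .sum fun j => h2 (hu i) (hu i) (hul i) (hul i) j j
  · exact .const_mul _ <| .sum fun i => .sum fun j => h2 (hb i) (hb i) (hbl i) (hbl i) j j
  · exact .const_mul _ <| .sum fun i => .sum fun j => h2 (hw i) (hw i) (hwl i) (hwl i) j j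
  · exact .const_mul _ <| .sum fun i => .sum fun j => h2 (hw i) (hw j) (hwl i) (hwl j) i j
  · exact .const_mul _ <| .sum fun i => .sum fun j => h2 (hu i) (hu j) (hul i) (hul j) i j
  · exact .const_mul _ <| .sum fun i => .sum fun j => h3 (hu j) (hu i) (hu i) (hul i) (hul i) j
  · exact .const_mul _ <| .sum fun i => .sum fun j => h3 (hu j) (hb i) (hb i) (hbl i) (hbl i) j
  · exact .const_mul _ <| .sum fun i => .sum fun j => h3 (hu j) (hw i) (hw i) (hwl i) (hwl i) j
  · exact .sum fun i => .sum fun j => h3 (hb j) (hu i) (hb i) (hul i) (hbl i) j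
  all_goals
    exact (h1 (hw _) (hu _) (hwl _) (hul _) _).sub (h1 (hw _) (hu _) (hwl _) (hul _) _)

theorem exists_norm_le_of_tendsto_cocompact {v : E3 → E3} (hv : Continuous v)
    (h0 : Tendsto v (cocompact E3) (𝓝 0)) : ∃ M, ∀ x, ‖v x‖ ≤ M :=
  ⟨_, (⟨⟨v, hv⟩, h0⟩ : C₀(E3, E3)).toBCF.norm_coe_le_norm⟩

/-- Interpolation with the sup bound: `‖v‖ ^ r ≤ M ^ (r - p) * ‖v‖ ^ p`. It is used with `r = 9/4`
for the growth on balls and `r = 4` for the pressure. -/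
theorem integrable_norm_rpow_of_bounded {v : E3 → E3} {p r M : ℝ} (hp : 1 ≤ p) (hpr : p ≤ r)
    (hv : MemLp v (ENNReal.ofReal p) volume) (hc : Continuous v) (hM : ∀ x, ‖v x‖ ≤ M) :
    Integrable fun x => ‖v x‖ ^ r := by
  have hp0 : 0 < p := by linarith
  have h1 : Integrable fun x => ‖v x‖ ^ p := by
    have := hv.integrable_norm_rpow (by simpa using hp0) ENNReal.ofReal_ne_top
    rwa [ENNReal.toReal_ofReal hp0.le] at this
  refine (h1.const_mul (M ^ (r - p))).mono'
    (hc.norm.rpow_const fun x => .inr (by linarith)).aestronglyMeasurable (.of_forall fun x => ?_)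
  rw [Real.norm_of_nonneg (by positivity)]
  rcases (norm_nonneg (v x)).eq_or_lt with h | h
  · rw [← h, Real.zero_rpow (by linarith), Real.zero_rpow hp0.ne', mul_zero]
  · rw [show r = (r - p) + p by ring, Real.rpow_add h]
    simp only [add_sub_cancel_right]
    gcongr
    exact hM x

/-- The components of a bounded continuous field as bounded continuous functions. -/
noncomputable def boundedComps {v : E3 → E3} {M : ℝ} (hv : Continuous v) (hM : ∀ x, ‖v x‖ ≤ M)
    (i : Fin 3) : E3 →ᵇ ℝ :=
  BoundedContinuousFunction.ofNormedAddCommGroup (comps v i)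
    ((EuclideanSpace.proj (𝕜 := ℝ) i).continuous.comp hv) M
    fun x => (PiLp.norm_apply_le (v x) i).trans (hM x)

theorem integrable_abs_comps_rpow {v : E3 → E3} {r : ℝ} (hr : 0 ≤ r) (hc : Continuous v)
    (h : Integrable fun x => ‖v x‖ ^ r) (i : Fin 3) : Integrable fun x => |comps v i x| ^ r := by
  have hci : Continuous (comps v i) := (EuclideanSpace.proj (𝕜 := ℝ) i).continuous.comp hc
  refine h.mono' (hci.abs.rpow_const fun x => .inr hr).aestronglyMeasurable
    (.of_forall fun x => ?_)
  rw [Real.norm_of_nonneg (by positivity)]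
  exact Real.rpow_le_rpow (abs_nonneg _) (PiLp.norm_apply_le (v x) i) hr

theorem integrable_comps_pow_four {v : E3 → E3} {p M : ℝ} (hp1 : 1 ≤ p) (hp2 : p < 9 / 4)
    (hv : MemLp v (ENNReal.ofReal p) volume) (hc : Continuous v) (hM : ∀ x, ‖v x‖ ≤ M)
    (i : Fin 3) : Integrable fun x => comps v i x ^ 4 := by
  have hp : p ≤ (4 : ℕ) := by
    push_cast
    linarith
  have h := integrable_abs_comps_rpow (by norm_num) hc
    (integrable_norm_rpow_of_bounded hp1 hp hv hc hM) i
  simp_rw [Real.rpow_natCast] at h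
  refine h.congr (.of_forall fun x => ?_)
  exact Even.pow_abs (by decide) _

theorem sublinearGrowth_comps_sq {v : E3 → E3} {p M : ℝ} (hp1 : 1 ≤ p) (hp2 : p < 9 / 4)
    (hv : MemLp v (ENNReal.ofReal p) volume) (hc : Continuous v) (hM : ∀ x, ‖v x‖ ≤ M)
    (i : Fin 3) : SublinearGrowth fun x => comps v i x ^ 2 :=
  sublinearGrowth_sq ((EuclideanSpace.proj (𝕜 := ℝ) i).continuous.comp hc)
    (integrable_abs_comps_rpow (by norm_num) hc
      (integrable_norm_rpow_of_bounded hp1 hp2.le hv hc hM) i)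

theorem eq_zero_of_partialD_eq_zero {v : E3 → E3} (hv : ContDiff ℝ ∞ v)
    (h0 : Tendsto v (cocompact E3) (𝓝 0)) (h : ∀ x i j, partialD j (comps v i) x = 0) (x : E3) :
    v x = 0 := by
  have hconst : ∀ y, v y = v x := fun y => by
    ext i
    refine is_const_of_fderiv_eq_zero (𝕜 := ℝ) ((hv.comps i).differentiable (by simp))
      (fun z => ?_) y x
    ext e
    simp [fderiv_eq_sum_partialD, h]
  exact tendsto_nhds_unique (tendsto_const_nhds.congr fun y => (hconst y).symm) h0

end liouville

theorem theorem1p3 (p : ℝ) (hp1 : 1 ≤ p) (hp2 : p < 9 / 4)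
    (u b w : E3 → E3) (P : E3 → ℝ) (hsol : IsSmoothSolution u b w P)
    (hu : MemLp u (ENNReal.ofReal p) volume)
    (hb : MemLp b (ENNReal.ofReal p) volume)
    (hw : MemLp w (ENNReal.ofReal p) volume)
    (hu0 : Tendsto u (cocompact E3) (𝓝 0))
    (hb0 : Tendsto b (cocompact E3) (𝓝 0))
    (hw0 : Tendsto w (cocompact E3) (𝓝 0)) :
    (∀ x, u x = 0) ∧ (∀ x, b x = 0) ∧ (∀ x, w x = 0) := by
  obtain ⟨Mu, hMu⟩ := exists_norm_le_of_tendsto_cocompact hsol.smooth_u.continuous hu0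
  obtain ⟨Mb, hMb⟩ := exists_norm_le_of_tendsto_cocompact hsol.smooth_b.continuous hb0
  obtain ⟨Mw, hMw⟩ := exists_norm_le_of_tendsto_cocompact hsol.smooth_w.continuous hw0
  have hus := hsol.smooth_u
  have hbs := hsol.smooth_b
  have hws := hsol.smooth_w
  have hdivu : ∀ y, ∑ j, partialD j (comps u j) y = 0 := fun y => by
    rw [← dvg_eq_sum hus, hsol.div_u]
  have hdivb : ∀ y, ∑ j, partialD j (comps b j) y = 0 := fun y => by
    rw [← dvg_eq_sum hbs, hsol.div_b]
  have hmom : ∀ x i, -∑ j, partialD j (partialD j (comps u i)) x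
      + ∑ j, comps u j x * partialD j (comps u i) x + partialD i P x
      = curl (comps w) i x + ∑ j, comps b j x * partialD j (comps b i) x := fun x i => by
    have h := congrArg (fun z : E3 => z i) (hsol.momentum x)
    simpa only [PiLp.add_apply, PiLp.neg_apply, laplacian_apply_eq_sum hus, adv_apply hus,
      adv_apply hbs, gradient_apply, rot_apply hws] using h
  have hang : ∀ x i, -∑ j, partialD j (partialD j (comps w i)) x
      + ∑ j, comps u j x * partialD j (comps w i) x
      = partialD i (fun y => ∑ j, partialD j (comps w j) y) x + curl (comps u) i x
        - 2 * comps w i x := fun x i => by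
    have h := congrArg (fun z : E3 => z i) (hsol.angular x)
    have hd : dvg w = fun y => ∑ j, partialD j (comps w j) y := funext fun y => dvg_eq_sum hws
    simp only [PiLp.add_apply, PiLp.neg_apply, PiLp.sub_apply, PiLp.smul_apply, smul_eq_mul,
      laplacian_apply_eq_sum hws, adv_apply hws, gradient_apply, rot_apply hus, hd] at h
    exact h
  have hmag : ∀ x i, -∑ j, partialD j (partialD j (comps b i)) x
      + ∑ j, comps u j x * partialD j (comps b i) x
      = ∑ j, comps b j x * partialD j (comps u i) x := fun x i => by
    have h := congrArg (fun z : E3 => z i) (hsol.magnetic x)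
    simpa only [PiLp.add_apply, PiLp.neg_apply, laplacian_apply_eq_sum hbs, adv_apply hbs,
      adv_apply hus] using h
  have hpress : Negligible fun x => ∑ i, comps u i x * partialD i P x :=
    negligible_pressure (u := boundedComps hus.continuous hMu)
      (b := boundedComps hbs.continuous hMb) (w := boundedComps hws.continuous hMw)
      hus.comps hbs.comps hws.comps hsol.smooth_P
      (integrable_comps_pow_four hp1 hp2 hu hus.continuous hMu)
      (integrable_comps_pow_four hp1 hp2 hb hbs.continuous hMb)
      (integrable_comps_pow_four hp1 hp2 hw hws.continuous hMw)
      (sublinearGrowth_comps_sq hp1 hp2 hu hus.continuous hMu) hdivu hdivb hmom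
  have hflux : Negligible (energyFlux (comps u) (comps b) (comps w)) :=
    negligible_energyFlux (u := boundedComps hus.continuous hMu)
      (b := boundedComps hbs.continuous hMb) (w := boundedComps hws.continuous hMw)
      hus.comps hbs.comps hws.comps
      (sublinearGrowth_comps_sq hp1 hp2 hu hus.continuous hMu)
      (sublinearGrowth_comps_sq hp1 hp2 hb hbs.continuous hMb)
      (sublinearGrowth_comps_sq hp1 hp2 hw hws.continuous hMw)
  have hcont : ∀ {v : E3 → E3}, ContDiff ℝ ∞ v → ∀ i j,
      Continuous fun x => partialD j (comps v i) x ^ 2 := fun hv i j =>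
    ((hv.comps i).partialD j).continuous.pow 2
  -- The Dirichlet energy density is nonnegative and lies below the negligible function formed by
  -- the fluxes minus the pressure term.
  have hzero := eq_zero_of_le_negligible
    (f := fun x => 1 / 2 * ∑ i, ∑ j, (partialD j (comps u i) x ^ 2 + partialD j (comps b i) x ^ 2
      + partialD j (comps w i) x ^ 2))
    (continuous_const.mul (continuous_finsetSum _ fun i _ => continuous_finsetSum _ fun j _ =>
      ((hcont hus i j).add (hcont hbs i j)).add (hcont hws i j)))
    (fun x => by positivity) (hflux.sub hpress)
    (fun x => energy_inequality hus.comps hbs.comps hws.comps hdivu hdivb (hmom x) (hang x)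
      (hmag x))
  have hall : ∀ x i j, partialD j (comps u i) x ^ 2 + partialD j (comps b i) x ^ 2
      + partialD j (comps w i) x ^ 2 = 0 := fun x i j => by
    have h1 := (mul_eq_zero.1 (hzero x)).resolve_left (by norm_num)
    rw [Finset.sum_eq_zero_iff_of_nonneg fun i _ => by positivity] at h1
    have h2 := h1 i (Finset.mem_univ i)
    rw [Finset.sum_eq_zero_iff_of_nonneg fun j _ => by positivity] at h2
    exact h2 j (Finset.mem_univ j)
  refine ⟨eq_zero_of_partialD_eq_zero hus hu0 fun x i j => ?_,
    eq_zero_of_partialD_eq_zero hbs hb0 fun x i j => ?_,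
    eq_zero_of_partialD_eq_zero hws hw0 fun x i j => ?_⟩
  all_goals
    refine pow_eq_zero_iff two_ne_zero |>.1 ?_
    linarith [hall x i j, sq_nonneg (partialD j (comps u i) x),
      sq_nonneg (partialD j (comps b i) x), sq_nonneg (partialD j (comps w i) x)]
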